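/- Consider a single-tier downlink cellular network whose base stations (BSs) form a homogeneous Poisson point process of intensity $\lambda>0$ in $\mathbb R^2$, enumerated as $x_0,x_1,\dots$ by increasing distance $r_k=\|x_k\|$ from a test user at the origin. The user is served by the nearest BS $x_0$, all BSs transmit with the same power $P>0$, the path-loss exponent is $\eta=4$, the noise is neglected, and the fading coefficients $h_0,h_1,\dots$ are i.i.d. circularly symmetric complex Gaussian $\mathcal{CN}(0,1)$ (Rayleigh fading), independent of the BS locations. With Gaussian interfering symbols, the aggregate interference power and the signal-to-interference ratio are $$\mathcal I=\sum_{k\ge 1}P|h_k|^2r_k^{-4},\qquad \Upsilon=\frac{P|h_0|^2r_0^{-4}}{\mathcal I},$$ where the series converges almost surely. Write $\mathcal L_{\mathcal I\mid r}(z)=\mathbb E[e^{-z\mathcal I}\mid r_0=r]$. Then the service distance $r_0$ has density $2\pi\lambda r e^{-\pi\lambda r^2}$ on $(0,\infty)$, and the following hold. 1. For every $a\ge 0$, the Laplace transform of the interference at $z=a r_0^4/P$, averaged over the service distance, is $$\int_0^\infty 2\pi\lambda r e^{-\pi\lambda r^2}\,\mathcal L_{\mathcal I\mid r}\!\Big(\frac{a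 r^4}{P}\Big)\,dr=\int_0^\infty 2\pi\lambda r\, e^{-\pi\lambda r^2(\sqrt a\arctan\sqrt a+1)}\,dr=\frac{1}{1+\sqrt a\,\arctan\sqrt a},$$ and this equals $\mathbb E\big[e^{-(a r_0^4/P)\mathcal I}\big]$. 2. For every $T\ge 0$, the outage probability is $$\mathbb P\{\Upsilon<T\}=1-\frac1{1+\sqrt T\arctan\sqrt T}.$$ 3. For all real $w_1,w_2$ and all $\beta_1,\beta_2>0$, the average symbol error probability (ASEP) is $$w_1\mathbb E\big[\operatorname{erfc}\sqrt{\beta_1\Upsilon}\big]+w_2\mathbb E\big[\operatorname{erfc}^2\sqrt{\beta_2\Upsilon}\big]=\sum_{c=1}^2 w_c\left(1-\frac{c}{\sqrt\pi}\int_0^\infty\frac{e^{-z}\operatorname{erfc}(\sqrt z\,\mathbf 1_{\{c=2\}})}{\sqrt z}\cdot\frac{dz}{1+\sqrt{z/\beta_c}\,\arctan\sqrt{z/\beta_c}}\right),$$ where $\operatorname{erfc}(x)=\frac{2}{\sqrt\pi}\int_x^\infty e^{-t^2}\,dt$. In particular, the outage probability and the ASEP do not depend on the BS intensity $\lambda$.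 -/

import Mathlib

open MeasureTheory ProbabilityTheory Set Filter
open scoped ENNReal NNReal

namespace Cellular

noncomputable section

/-- The plane in which the base stations (BSs) live; the test user sits at the origin. -/
abbrev Plane : Type := EuclideanSpace ℝ (Fin 2)

/-- Number of points of the sequence `X 0 ω, X 1 ω, …` that lie in `B` (possibly infinite). -/
def count {Ω : Type*} (X : ℕ → Ω → Plane) (B : Set Plane) (ω : Ω) : ℕ∞ :=
  {n : ℕ | X n ω ∈ B}.encard

/-- The random points `X 0, X 1, …` form a homogeneous Poisson point process (PPP) of intensity
`lam` in the plane: the number of points in a bounded Borel set is Poisson distributed with mean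
`lam` times the area, and the numbers of points in pairwise disjoint sets are independent. -/
structure IsPPP {Ω : Type*} [MeasurableSpace Ω] (μ : Measure Ω) (lam : ℝ)
    (X : ℕ → Ω → Plane) : Prop where
  measurable : ∀ n, Measurable (X n)
  count_law : ∀ B : Set Plane, MeasurableSet B → Bornology.IsBounded B →
    HasLaw (count X B)
      ((poissonMeasure (ENNReal.ofReal lam * volume B).toNNReal).map (fun k : ℕ => (k : ℕ∞))) μ
  count_indep : ∀ (m : ℕ) (B : Fin m → Set Plane), (∀ i, MeasurableSet (B i)) →
    (∀ i, Bornology.IsBounded (B i)) → (Pairwise fun i j => Disjoint (B i) (B j)) →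
    iIndepFun (fun i => count X (B i)) μ

/-- The circularly symmetric complex Gaussian law `𝒞𝒩(0, 1)`: independent centred Gaussian real
and imaginary parts of variance `1/2` each. -/
def complexGaussian : Measure ℂ :=
  ((gaussianReal 0 (1 / 2)).prod (gaussianReal 0 (1 / 2))).map
    (fun p : ℝ × ℝ => (p.1 : ℂ) + (p.2 : ℂ) * Complex.I)

/-- Single-tier downlink network with Rayleigh fading and nearest-BS association: the BSs form a
PPP of intensity `lam`, enumerated by increasing distance from the test user (so `X 0` is the
serving BS); the fading coefficients `h n` of the BSs `X n` are i.i.d. `𝒞𝒩(0, 1)` and independent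
of the BS locations. -/
structure IsDownlinkNetwork {Ω : Type*} [MeasurableSpace Ω] (μ : Measure Ω) (lam : ℝ)
    (X : ℕ → Ω → Plane) (h : ℕ → Ω → ℂ) : Prop where
  ppp : IsPPP μ lam X
  ordered : ∀ᵐ ω ∂μ, Monotone fun n => ‖X n ω‖
  fading_measurable : ∀ n, Measurable (h n)
  fading_law : ∀ n, HasLaw (h n) complexGaussian μ
  fading_indep : iIndepFun h μ
  fading_indep_ppp : IndepFun (fun ω n => X n ω) (fun ω n => h n ω) μ

/-- Service distance `r₀`. -/
def serviceDist {Ω : Type*} (X : ℕ → Ω → Plane) (ω : Ω) : ℝ := ‖X 0 ω‖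

/-- Power received from the `k`-th BS, for transmit power `P` and path-loss exponent `η`. -/
def rxPower {Ω : Type*} (P η : ℝ) (X : ℕ → Ω → Plane) (h : ℕ → Ω → ℂ) (k : ℕ) (ω : Ω) : ℝ :=
  P * ‖h k ω‖ ^ 2 * ‖X k ω‖ ^ (-η)

/-- Aggregate interference power: the sum over all BSs except the serving one. -/
def interference {Ω : Type*} (P η : ℝ) (X : ℕ → Ω → Plane) (h : ℕ → Ω → ℂ) (ω : Ω) : ℝ :=
  ∑' k : ℕ, rxPower P η X h (k + 1) ω

/-- Signal-to-interference-plus-noise ratio with noise power `N₀`. -/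
def sinr {Ω : Type*} (P η N₀ : ℝ) (X : ℕ → Ω → Plane) (h : ℕ → Ω → ℂ) (ω : Ω) : ℝ :=
  rxPower P η X h 0 ω / (interference P η X h ω + N₀)

/-- Laplace transform at `z` of the aggregate interference, conditionally on `r₀ = r`. -/
def condLT {Ω : Type*} [MeasurableSpace Ω] (μ : Measure Ω) [IsFiniteMeasure μ] (P η : ℝ)
    (X : ℕ → Ω → Plane) (h : ℕ → Ω → ℂ) (z r : ℝ) : ℝ :=
  ∫ y, Real.exp (-(z * y)) ∂(condDistrib (interference P η X h) (serviceDist X) μ r)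

/-- Complementary error function. -/
def erfc (x : ℝ) : ℝ := 2 / √Real.pi * ∫ t in Ioi x, Real.exp (-t ^ 2)

/-- Outage probability at threshold `T`. -/
def outage {Ω : Type*} [MeasurableSpace Ω] (μ : Measure Ω) (Υ : Ω → ℝ) (T : ℝ) : ℝ :=
  μ.real {ω | Υ ω < T}

/-- Average symbol error probability (ASEP) with modulation parameters `w₁, w₂, β₁, β₂`, for a
receiver with signal-to-interference-plus-noise ratio `Υ`. -/
def asep {Ω : Type*} [MeasurableSpace Ω] (μ : Measure Ω) (w₁ w₂ β₁ β₂ : ℝ) (Υ : Ω → ℝ) : ℝ :=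
  w₁ * ∫ ω, erfc √(β₁ * Υ ω) ∂μ + w₂ * ∫ ω, erfc √(β₂ * Υ ω) ^ 2 ∂μ

end

end Cellular

namespace Cellular

/-! ### Rayleigh fading -/

/-! Everything reduces to one expectation. Put s_k = r_k². Given the locations, each |h_k|² is a
standard exponential, so averaging the fading out of exp(-a Σ (s_0/s_k)² |h_k|²) leaves the product
of 1/(1 + a (s_0/s_k)²) over k ≥ 1; its partial products are `fadingProd`. Its mean is 1/(1 + √a
arctan √a) because the s_k form a Poisson process of rate πλ on the half-line. Beyond s_0 the
product has conditional mean exp(-πλ s_0 √a arctan √a), the exponent being the integral over u > 1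
of a/(u² + a), scaled by s_0. Since πλ s_0 is a standard exponential, λ drops out.

The definition of a Poisson process gives only independent Poisson counts, so the conditioning on
s_0 is done by discretisation. The half-line is cut into cells of mesh D. The event that the nearest
point lies in cell i depends on the counts of cells 0, ..., i only, and the later cells contribute
Poisson generating functions (`IsPPP.setIntegral_servingCell`). Keeping only points with s_k ≤ M s_0
makes the number of cells finite. The resulting Riemann sum is within 1 of its integral, uniformly
in i (`abs_sum_sub_windowExponent_le`), so the error is O(D) and vanishes as D → 0
(`IsPPP.integral_fadingProd_windowLen`). Then M → ∞ (`IsPPP.tendsto_integral_fadingProd`).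

Convergence of the interference is a consequence rather than an input: exp(-a·∞) = 0, and letting a
→ 0 in the closed form shows that the sum is finite almost surely. Coverage is the same quantity as
the Laplace transform, because P(V ≤ |h_0|²) = E e^{-V} for V ≥ 0 independent of the exponential
|h_0|². The ASEP is an integral of coverage probabilities, obtained by writing erfc √x and its
square as 1 minus a primitive and applying Fubini. -/

lemma complexGaussian_eq_map :
    complexGaussian = ((gaussianReal 0 (1 / 2)).prod (gaussianReal 0 (1 / 2))).map
      Complex.measurableEquivRealProd.symm := by
  unfold complexGaussian
  congr 1
  ext p
  rw [Complex.measurableEquivRealProd_symm_apply]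
  apply Complex.ext <;> simp

instance : IsProbabilityMeasure complexGaussian := by
  rw [complexGaussian_eq_map]
  exact Measure.isProbabilityMeasure_map (by fun_prop)

/-- Radial integrals against `𝒞𝒩(0, 1)`. -/
lemma integral_norm_complexGaussian (f : ℝ → ℝ) :
    ∫ z, f ‖z‖ ∂complexGaussian = ∫ r in Ioi (0 : ℝ), 2 * r * Real.exp (-r ^ 2) * f r := by
  have hv : ((1 / 2 : ℝ≥0)) ≠ 0 := by norm_num
  have hpdf : ∀ x : ℝ, gaussianPDFReal 0 (1 / 2) x = (√Real.pi)⁻¹ * Real.exp (-x ^ 2) := by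
    intro x
    have : (√2 : ℝ) ≠ 0 := by positivity
    simp [gaussianPDFReal]
    field_simp
  rw [complexGaussian_eq_map, integral_map_equiv, gaussianReal_of_var_ne_zero _ hv,
    prod_withDensity (by fun_prop) (by fun_prop), integral_withDensity_eq_integral_toReal_smul
      (by fun_prop) (ae_of_all _ fun _ => ENNReal.mul_lt_top (by simp [gaussianPDF])
        (by simp [gaussianPDF]))]
  have key : ∀ p : ℝ × ℝ, (gaussianPDF 0 (1 / 2) p.1 * gaussianPDF 0 (1 / 2) p.2).toReal •
      f ‖Complex.measurableEquivRealProd.symm p‖ =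
      (fun r => Real.pi⁻¹ * Real.exp (-r ^ 2) * f r) ‖Complex.measurableEquivRealProd.symm p‖ := by
    intro p
    rw [ENNReal.toReal_mul, toReal_gaussianPDF, toReal_gaussianPDF, hpdf, hpdf,
      Complex.measurableEquivRealProd_symm_apply]
    have h1 : ‖(⟨p.1, p.2⟩ : ℂ)‖ ^ 2 = p.1 ^ 2 + p.2 ^ 2 := by
      rw [← Complex.normSq_eq_norm_sq, Complex.normSq_mk]; ring
    have h2 : Real.pi⁻¹ = (√Real.pi)⁻¹ * (√Real.pi)⁻¹ := by
      rw [← mul_inv, Real.mul_self_sqrt Real.pi_pos.le]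
    simp only [smul_eq_mul]
    rw [h1, neg_add, Real.exp_add, h2]
    ring
  simp_rw [key]
  have := (Complex.volume_preserving_equiv_real_prod.symm).integral_comp'
    (g := fun z : ℂ => (fun r => Real.pi⁻¹ * Real.exp (-r ^ 2) * f r) ‖z‖)
  -- Polar coordinates: dimension 2, unit disc area π and radial factor r turn the density e^{-r²}/π
  -- into 2 r e^{-r²}.
  rw [← Measure.volume_eq_prod, this,
    integral_fun_norm_addHaar volume (fun r => Real.pi⁻¹ * Real.exp (-r ^ 2) * f r)]
  have hb : (volume : Measure ℂ).real (Metric.ball 0 1) = Real.pi := by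
    simp [Measure.real, Complex.volume_ball]
  rw [hb, Complex.finrank_real_complex]
  simp only [smul_eq_mul, nsmul_eq_mul]
  rw [← integral_const_mul, ← integral_const_mul]
  refine integral_congr_ae (ae_of_all _ fun r => ?_)
  have := Real.pi_ne_zero
  simp
  field_simp

lemma integral_Ioi_mul_exp_neg_mul_sq {b : ℝ} (hb : 0 < b) {c : ℝ} (hc : 0 ≤ c) :
    ∫ r in Ioi c, 2 * r * Real.exp (-(b * r ^ 2)) = Real.exp (-(b * c ^ 2)) / b := by
  have hd : ∀ x ∈ Ici c, HasDerivAt (fun r => -(Real.exp (-(b * r ^ 2)) / b))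
      (2 * x * Real.exp (-(b * x ^ 2))) x := by
    intro x _
    have := ((((hasDerivAt_pow 2 x).const_mul b).neg).exp.div_const b).neg
    refine HasDerivAt.congr_deriv this ?_
    simp only [Pi.neg_apply, Nat.cast_ofNat, Nat.add_one_sub_one, pow_one]
    field_simp
  have ht : Tendsto (fun r => -(Real.exp (-(b * r ^ 2)) / b)) atTop (nhds 0) := by
    have : Tendsto (fun r : ℝ => b * r ^ 2) atTop atTop :=
      (tendsto_pow_atTop two_ne_zero).const_mul_atTop hb
    simpa using ((Real.tendsto_exp_neg_atTop_nhds_zero.comp this).div_const b).neg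
  rw [integral_Ioi_of_hasDerivAt_of_nonneg' hd (fun x hx => ?_) ht]
  · ring
  · have : 0 ≤ x := hc.trans (le_of_lt hx)
    positivity

lemma integral_exp_neg_norm_sq_complexGaussian {t : ℝ} (ht : 0 ≤ t) :
    ∫ z, Real.exp (-(t * ‖z‖ ^ 2)) ∂complexGaussian = 1 / (1 + t) := by
  rw [integral_norm_complexGaussian (fun r => Real.exp (-(t * r ^ 2)))]
  have := integral_Ioi_mul_exp_neg_mul_sq (b := 1 + t) (by positivity) le_rfl
  simp only [ne_eq, OfNat.ofNat_ne_zero, not_false_eq_true, zero_pow, mul_zero, neg_zero,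
    Real.exp_zero] at this
  rw [← this]
  refine integral_congr_ae (ae_of_all _ fun r => ?_)
  simp only
  rw [mul_assoc, ← Real.exp_add]
  ring_nf

/-- The squared modulus of a `𝒞𝒩(0, 1)` variable is exponentially distributed. -/
lemma complexGaussian_real_norm_sq_ge {t : ℝ} (ht : 0 ≤ t) :
    complexGaussian.real {z | t ≤ ‖z‖ ^ 2} = Real.exp (-t) := by
  have hm : MeasurableSet {z : ℂ | t ≤ ‖z‖ ^ 2} := measurableSet_le (by fun_prop) (by fun_prop)
  rw [← integral_indicator_one hm]
  have h1 : ∀ z : ℂ, indicator {z : ℂ | t ≤ ‖z‖ ^ 2} (1 : ℂ → ℝ) z =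
      indicator {r : ℝ | t ≤ r ^ 2} (1 : ℝ → ℝ) ‖z‖ := by
    intro z; simp [indicator]
  simp_rw [h1]
  rw [integral_norm_complexGaussian]
  have := integral_Ioi_mul_exp_neg_mul_sq (b := 1) one_pos (Real.sqrt_nonneg t)
  rw [Real.sq_sqrt ht] at this
  simp only [one_mul, div_one] at this
  rw [← this, ← integral_Ici_eq_integral_Ioi (x := √t),
    ← integral_indicator measurableSet_Ici, ← integral_indicator measurableSet_Ioi]
  refine integral_congr_ae ?_
  -- For t = 0 the two indicators differ at r = 0, hence the removal of this null point.
  filter_upwards [compl_mem_ae_iff.2 (measure_singleton (0 : ℝ))] with r hr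
  have hr : r ≠ 0 := hr
  simp only [indicator, mem_Ioi, mem_Ici, mem_ofPred_eq, Pi.one_apply]
  rcases lt_or_gt_of_ne hr with h | h
  · have : ¬ √t ≤ r := fun h' => absurd (Real.sqrt_nonneg t) (by linarith)
    simp [this, h.not_gt]
  · have h2 : √t ≤ r ↔ t ≤ r ^ 2 := Real.sqrt_le_left h.le
    by_cases h3 : √t ≤ r
    · simp [h, h3, h2.1 h3]
    · simp [h3, mt h2.2 h3]

section Fading

variable {Ω : Type*} [MeasurableSpace Ω] {μ : Measure Ω} {h : ℕ → Ω → ℂ}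

lemma integral_exp_neg_sum_fading (hm : ∀ n, Measurable (h n))
    (hl : ∀ n, HasLaw (h n) complexGaussian μ) (hi : iIndepFun h μ) (n : ℕ) (c : ℕ → ℝ)
    (hc : ∀ k, 0 ≤ c k) :
    ∫ ω, Real.exp (-∑ k ∈ Finset.range n, c k * ‖h (k + 1) ω‖ ^ 2) ∂μ =
      ∏ k ∈ Finset.range n, 1 / (1 + c k) := by
  have hi' : iIndepFun (fun k : Fin n => h (k + 1)) μ :=
    hi.precomp (g := fun k : Fin n => (k : ℕ) + 1) (fun a b hab => by
      simpa [Fin.ext_iff] using hab)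
  have := hi'.integral_fun_prod_comp (f := fun (k : Fin n) (z : ℂ) => Real.exp (-(c k * ‖z‖ ^ 2)))
    (fun k => (hm _).aemeasurable) (fun k => by fun_prop)
  simp_rw [← Finset.sum_neg_distrib, Real.exp_sum, Finset.prod_range]
  rw [this]
  refine Finset.prod_congr rfl fun k _ => ?_
  rw [← integral_exp_neg_norm_sq_complexGaussian (hc k)]
  exact (hl (k + 1)).integral_comp (f := fun z => Real.exp (-(c k * ‖z‖ ^ 2))) (by fun_prop)

/-- The right-hand side is E e^{-V} for the weighted sum V of the interfering powers. As |h_0|² is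
exponential and independent of V, conditioning on V gives P(V ≤ |h_0|²) = E e^{-V}. -/
lemma measureReal_sum_fading_le [IsProbabilityMeasure μ] (hm : ∀ n, Measurable (h n))
    (hl : ∀ n, HasLaw (h n) complexGaussian μ) (hi : iIndepFun h μ) (n : ℕ) (c : ℕ → ℝ)
    (hc : ∀ k, 0 ≤ c k) :
    μ.real {ω | ∑ k ∈ Finset.range n, c k * ‖h (k + 1) ω‖ ^ 2 ≤ ‖h 0 ω‖ ^ 2} =
      ∏ k ∈ Finset.range n, 1 / (1 + c k) := by
  rw [← integral_exp_neg_sum_fading hm hl hi n c hc]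
  set V : Ω → ℝ := fun ω => ∑ k ∈ Finset.range n, c k * ‖h (k + 1) ω‖ ^ 2 with hV
  have hVm : Measurable V := by fun_prop
  -- The serving and interfering powers are put in one independent family, so that the entry at 0 is
  -- independent of the sum of the others; the weights are shifted by one to match.
  let g : ℕ → ℂ → ℝ := fun k z => if k = 0 then ‖z‖ ^ 2 else c (k - 1) * ‖z‖ ^ 2
  have hg : ∀ k, Measurable (g k) := by
    intro k
    by_cases hk : k = 0 <;> simp only [g, hk, if_true, if_false] <;> fun_prop
  have hind := (hi.comp g hg).indepFun_finsetSum_of_notMem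
    (fun k => (hg k).comp (hm k)) (s := (Finset.range n).map ⟨Nat.succ, Nat.succ_injective⟩)
    (i := 0) (by simp)
  have e1 : (∑ j ∈ (Finset.range n).map ⟨Nat.succ, Nat.succ_injective⟩, g j ∘ h j) = V := by
    ext ω
    simp [Finset.sum_map, g, hV]
  have e2 : g 0 ∘ h 0 = fun ω => ‖h 0 ω‖ ^ 2 := by ext; simp [g]
  rw [e1, e2] at hind
  have hUm : Measurable fun ω => ‖h 0 ω‖ ^ 2 := by fun_prop
  have hprod := (indepFun_iff_map_prod_eq_prod_map_map hVm.aemeasurable hUm.aemeasurable).1 hind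
  have hS : MeasurableSet {p : ℝ × ℝ | p.1 ≤ p.2} := measurableSet_le (by fun_prop) (by fun_prop)
  have hpm : IsProbabilityMeasure (μ.map fun ω => ‖h 0 ω‖ ^ 2) :=
    Measure.isProbabilityMeasure_map hUm.aemeasurable
  have hpm' : IsProbabilityMeasure (μ.map V) := Measure.isProbabilityMeasure_map hVm.aemeasurable
  have : {ω | V ω ≤ ‖h 0 ω‖ ^ 2} = (fun ω => (V ω, ‖h 0 ω‖ ^ 2)) ⁻¹' {p : ℝ × ℝ | p.1 ≤ p.2} := rfl
  rw [this, ← map_measureReal_apply (by fun_prop) hS, hprod, Measure.real, Measure.prod_apply hS,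
    ← integral_toReal (measurable_measure_prodMk_left hS).aemeasurable
      (ae_of_all _ fun _ => measure_lt_top _ _), integral_map hVm.aemeasurable]
  · refine integral_congr_ae (ae_of_all _ fun ω => ?_)
    have hV0 : 0 ≤ V ω := Finset.sum_nonneg fun k _ => mul_nonneg (hc k) (by positivity)
    simp only
    rw [← complexGaussian_real_norm_sq_ge hV0, ← Measure.real, map_measureReal_apply (by fun_prop)
      (measurable_prodMk_left hS)]
    exact (hl 0).measureReal_eq (p := fun z => V ω ≤ ‖z‖ ^ 2)
      (measurableSet_le (by fun_prop) (by fun_prop))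
  · exact (measurable_measure_prodMk_left hS).ennreal_toReal.aestronglyMeasurable

end Fading

/-! ### Discretisation of an increasing sequence -/

/-- The mean `1 / (1 + a y²)` of `exp (-a y² E)` for a standard exponential variable `E`. -/
noncomputable def rayleighLT (a y : ℝ) : ℝ := 1 / (1 + a * y ^ 2)

lemma rayleighLT_nonneg {a : ℝ} (ha : 0 ≤ a) (y : ℝ) : 0 ≤ rayleighLT a y := by
  unfold rayleighLT; positivity

lemma rayleighLT_le_one {a : ℝ} (ha : 0 ≤ a) (y : ℝ) : rayleighLT a y ≤ 1 := by
  unfold rayleighLT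
  have : 0 ≤ a * y ^ 2 := by positivity
  rw [div_le_one (by positivity)]
  linarith

lemma continuous_rayleighLT {a : ℝ} (ha : 0 ≤ a) : Continuous (rayleighLT a) := by
  unfold rayleighLT
  refine continuous_const.div (by fun_prop) fun y => ?_
  positivity

/-- Index of the cell of mesh `D` that contains `t`. -/
noncomputable def cellIdx (D t : ℝ) : ℕ := ⌈t / D⌉₊

lemma cellIdx_mono {D : ℝ} (hD : 0 < D) : Monotone (cellIdx D) := fun s t hst =>
  Nat.ceil_mono (by gcongr)

lemma le_mul_cellIdx {D : ℝ} (hD : 0 < D) (t : ℝ) : t ≤ D * cellIdx D t := by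
  have := Nat.le_ceil (t / D)
  rw [div_le_iff₀ hD] at this
  unfold cellIdx
  linarith

lemma mul_cellIdx_lt {D : ℝ} (hD : 0 < D) {t : ℝ} (ht : 0 ≤ t) : D * cellIdx D t < t + D := by
  have := Nat.ceil_lt_add_one (div_nonneg ht hD.le)
  rw [← sub_lt_iff_lt_add, lt_div_iff₀ hD] at this
  unfold cellIdx
  linarith

lemma tendsto_mul_cellIdx {t : ℝ} (ht : 0 ≤ t) {D : ℕ → ℝ} (hD : ∀ n, 0 < D n)
    (hD0 : Tendsto D atTop (nhds 0)) :
    Tendsto (fun n => D n * cellIdx (D n) t) atTop (nhds t) := by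
  refine tendsto_of_tendsto_of_tendsto_of_le_of_le tendsto_const_nhds (h := fun n => t + D n) ?_
    (fun n => le_mul_cellIdx (hD n) t) (fun n => (mul_cellIdx_lt (hD n) ht).le)
  simpa using tendsto_const_nhds.add hD0

/-- Product of `rayleighLT` over the cells after the one of `s 0`, up to `M` times its index,
each cell being counted with the number of `s n` in it. -/
noncomputable def cellProd (a D : ℝ) (M : ℕ) (s : ℕ → ℝ) : ℝ :=
  ∏ x ∈ Finset.range (M * cellIdx D (s 0) - cellIdx D (s 0)),
    rayleighLT a (cellIdx D (s 0) / (cellIdx D (s 0) + 1 + x : ℕ)) ^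
      ({n | cellIdx D (s n) = cellIdx D (s 0) + 1 + x}.encard.toNat)

lemma cellProd_nonneg {a : ℝ} (ha : 0 ≤ a) (D : ℝ) (M : ℕ) (s : ℕ → ℝ) : 0 ≤ cellProd a D M s :=
  Finset.prod_nonneg fun _ _ => pow_nonneg (rayleighLT_nonneg ha _) _

lemma cellProd_le_one {a : ℝ} (ha : 0 ≤ a) (D : ℝ) (M : ℕ) (s : ℕ → ℝ) : cellProd a D M s ≤ 1 :=
  Finset.prod_le_one (fun _ _ => pow_nonneg (rayleighLT_nonneg ha _) _)
    fun _ _ => pow_le_one₀ (rayleighLT_nonneg ha _) (rayleighLT_le_one ha _)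

/-- Grouping points by cell turns the product over cells into a product over points. The range `K`
does not depend on `D`, so the limit D → 0 can be taken factor by factor. -/
lemma cellProd_eq {a D : ℝ} (hD : 0 < D) (hD1 : D ≤ 1) {M K : ℕ} {s : ℕ → ℝ} (h0 : 0 ≤ s 0)
    (hK : ∀ k, K ≤ k → M * (s 0 + 1) < s k) :
    cellProd a D M s = ∏ k ∈ Finset.range K,
      if cellIdx D (s 0) < cellIdx D (s k) ∧ cellIdx D (s k) ≤ M * cellIdx D (s 0)
        then rayleighLT a (cellIdx D (s 0) / cellIdx D (s k)) else 1 := by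
  set i := cellIdx D (s 0) with hi
  -- Rounding up moves `s 0` by less than D ≤ 1, whence the margin `s 0 + 1` in `hK`.
  have hlt : ∀ k, cellIdx D (s k) ≤ M * i → k < K := by
    intro k hk
    by_contra hkK
    have h1 := hK k (not_lt.1 hkK)
    have h2 := le_mul_cellIdx hD (s k)
    have h3 := (mul_cellIdx_lt hD h0).le
    rw [← hi] at h3
    have h4 : D * (cellIdx D (s k) : ℝ) ≤ D * (M * i) := by
      gcongr; exact_mod_cast hk
    have h5 : (M : ℝ) * (D * i) ≤ M * (s 0 + 1) := by gcongr; linarith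
    nlinarith
  rw [← Finset.prod_filter]
  set T := (Finset.range K).filter fun k => i < cellIdx D (s k) ∧ cellIdx D (s k) ≤ M * i with hT
  have hmap : ∀ k ∈ T, cellIdx D (s k) - (i + 1) ∈ Finset.range (M * i - i) := by
    intro k hk
    simp only [hT, Finset.mem_filter, Finset.mem_range] at hk ⊢
    omega
  rw [← Finset.prod_fiberwise_of_maps_to hmap]
  unfold cellProd
  rw [← hi]
  refine Finset.prod_congr rfl fun x hx => ?_
  have hx' := Finset.mem_range.1 hx
  have hset : {n | cellIdx D (s n) = i + 1 + x} =
      (T.filter fun k => cellIdx D (s k) - (i + 1) = x : Finset ℕ) := by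
    ext k
    simp only [mem_ofPred_eq, Finset.coe_filter, hT, Finset.mem_filter, Finset.mem_range]
    constructor
    · intro hk
      exact ⟨⟨hlt k (by omega), by omega, by omega⟩, by omega⟩
    · rintro ⟨⟨_, _, _⟩, _⟩
      omega
  rw [hset, Set.encard_coe_eq_coe_finsetCard, ENat.toNat_natCast, ← Finset.prod_const]
  refine Finset.prod_congr rfl fun k hk => ?_
  have : cellIdx D (s k) = i + 1 + x := by
    have : k ∈ {n | cellIdx D (s n) = i + 1 + x} := by rw [hset]; exact hk
    exact this
  rw [this]

/-- Number of indices `k` with `s (k + 1) ≤ c * s 0`, for monotone unbounded `s`. -/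
noncomputable def windowLen (c : ℝ) (s : ℕ → ℝ) : ℕ := sInf {k | c * s 0 < s (k + 1)}

lemma lt_windowLen_iff {c : ℝ} {s : ℕ → ℝ} (hs : Monotone s) (hs' : Tendsto s atTop atTop) (k : ℕ) :
    k < windowLen c s ↔ s (k + 1) ≤ c * s 0 := by
  constructor
  · intro h
    have := Nat.notMem_of_lt_sInf h
    simpa using this
  · intro h
    by_contra hk
    have hne : {k | c * s 0 < s (k + 1)}.Nonempty :=
      ((hs'.comp (tendsto_add_atTop_nat 1)).eventually_gt_atTop (c * s 0)).exists
    have h1 : c * s 0 < s (windowLen c s + 1) := Nat.sInf_mem hne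
    have h2 := hs (Nat.succ_le_succ (not_lt.1 hk))
    simp only [Nat.succ_eq_add_one] at h2
    linarith

lemma tendsto_windowLen {s : ℕ → ℝ} (hs : Monotone s) (hs' : Tendsto s atTop atTop)
    (h0 : 0 < s 0) : Tendsto (fun M : ℕ => windowLen M s) atTop atTop := by
  refine tendsto_atTop.2 fun b => ?_
  filter_upwards [(tendsto_natCast_atTop_atTop (R := ℝ)).eventually_ge_atTop (s (b + 1) / s 0)]
    with M hM
  exact ((lt_windowLen_iff hs hs' b).2 ((div_le_iff₀ h0).1 hM)).le

/-- Ratios of cell indices converge to ratios of points. Points sharing the cell of `s 0` are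
missing from `cellProd`; the gap `s 0 < s 1` ensures that there are none once the mesh is small. -/
lemma tendsto_cellProd {a : ℝ} (ha : 0 ≤ a) {M : ℕ} {s : ℕ → ℝ} (hs : Monotone s)
    (hs' : Tendsto s atTop atTop) (h0 : 0 < s 0) (h01 : s 0 < s 1) {D : ℕ → ℝ}
    (hD : ∀ n, 0 < D n) (hD1 : ∀ n, D n ≤ 1) (hD0 : Tendsto D atTop (nhds 0)) :
    Tendsto (fun n => cellProd a (D n) M s) atTop
      (nhds (∏ k ∈ Finset.range (windowLen M s), rayleighLT a (s 0 / s (k + 1)))) := by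
  obtain ⟨K, hK⟩ := ((hs'.comp (tendsto_add_atTop_nat 1)).eventually_gt_atTop
    (M * (s 0 + 1))).exists
  have hK' : ∀ k, K + 1 ≤ k → M * (s 0 + 1) < s k := fun k hk => lt_of_lt_of_le hK (hs hk)
  have hwK : windowLen M s ≤ K := by
    by_contra h
    have h1 := (lt_windowLen_iff hs hs' K).1 (not_le.1 h)
    have h2 := hK' (K + 1) le_rfl
    have : (0 : ℝ) ≤ M := Nat.cast_nonneg _
    nlinarith
  have hlim : ∏ k ∈ Finset.range (windowLen M s), rayleighLT a (s 0 / s (k + 1)) =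
      ∏ k ∈ Finset.range (K + 1), if k ≠ 0 ∧ s k ≤ M * s 0 then rayleighLT a (s 0 / s k) else 1 := by
    rw [Finset.prod_range_succ']
    simp only [ne_eq, Nat.add_eq_zero_iff, one_ne_zero, and_false, not_false_eq_true, true_and,
      not_true_eq_false, false_and, if_false, mul_one]
    rw [← Finset.prod_filter]
    refine Finset.prod_congr ?_ fun _ _ => rfl
    ext k
    simp only [Finset.mem_range, Finset.mem_filter, lt_windowLen_iff hs hs']
    constructor
    · intro h
      exact ⟨lt_of_lt_of_le ((lt_windowLen_iff hs hs' k).2 h) hwK, h⟩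
    · exact fun h => h.2
  rw [hlim]
  simp_rw [fun n => cellProd_eq (a := a) (hD n) (hD1 n) h0.le hK']
  refine tendsto_finsetProd _ fun k _ => ?_
  have hsk : s 0 ≤ s k := hs (Nat.zero_le k)
  have hM0 : (0 : ℝ) ≤ M := Nat.cast_nonneg _
  by_cases hk : k = 0
  · simp [hk]
  have hk1 : s 0 < s k := lt_of_lt_of_le h01 (hs (Nat.one_le_iff_ne_zero.2 hk))
  by_cases hkM : s k ≤ M * s 0
  · rw [if_pos ⟨hk, hkM⟩]
    have hT : Tendsto (fun n => rayleighLT a (cellIdx (D n) (s 0) / cellIdx (D n) (s k))) atTop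
        (nhds (rayleighLT a (s 0 / s k))) := by
      refine ((continuous_rayleighLT ha).tendsto _).comp ?_
      refine ((tendsto_mul_cellIdx h0.le hD hD0).div
        (tendsto_mul_cellIdx (h0.le.trans hsk) hD hD0) (h0.trans hk1).ne').congr fun n => ?_
      exact mul_div_mul_left _ _ (hD n).ne'
    refine hT.congr' ?_
    filter_upwards [hD0.eventually_lt_const (sub_pos.2 hk1)] with n hn
    rw [if_pos]
    have e1 := mul_cellIdx_lt (hD n) h0.le
    have e2 := le_mul_cellIdx (hD n) (s k)
    have e3 := le_mul_cellIdx (hD n) (s 0)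
    constructor
    · have : D n * (cellIdx (D n) (s 0) : ℝ) < D n * cellIdx (D n) (s k) := by linarith
      exact_mod_cast lt_of_mul_lt_mul_left this (hD n).le
    -- Rounding up keeps the closed end of the window: s k ≤ M s 0 ≤ D M i, equality included.
    · refine Nat.ceil_le.2 ((div_le_iff₀ (hD n)).2 ?_)
      push_cast
      nlinarith
  · rw [if_neg (fun h => hkM h.2)]
    refine tendsto_const_nhds.congr' ?_
    have : Tendsto (fun n => M * (s 0 + D n)) atTop (nhds (M * (s 0 + 0))) :=
      (tendsto_const_nhds.add hD0).const_mul _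
    rw [add_zero] at this
    filter_upwards [this.eventually_lt_const (not_le.1 hkM)] with n hn
    rw [if_neg]
    rintro ⟨_, h2⟩
    have e1 := (mul_cellIdx_lt (hD n) h0.le).le
    have e2 := le_mul_cellIdx (hD n) (s k)
    have e4 : D n * (cellIdx (D n) (s k) : ℝ) ≤ D n * (M * cellIdx (D n) (s 0)) := by
      have := (hD n).le
      gcongr; exact_mod_cast h2
    nlinarith

/-! ### The interference exponent -/

/-- `∫ u in 1..M, (1 - rayleighLT a u⁻¹)`. -/
noncomputable def windowExponent (a M : ℝ) : ℝ :=
  √a * (Real.arctan (M / √a) - Real.arctan (1 / √a))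

lemma windowExponent_nonneg {a M : ℝ} (hM : 1 ≤ M) : 0 ≤ windowExponent a M := by
  refine mul_nonneg (Real.sqrt_nonneg a) (sub_nonneg.2 (Real.arctan_mono ?_))
  gcongr

/-- The limit √a (π/2 - arctan (1/√a)) is √a arctan √a by the inversion formula for arctan. -/
lemma tendsto_windowExponent {a : ℝ} (ha : 0 < a) :
    Tendsto (fun M : ℕ => windowExponent a M) atTop (nhds (√a * Real.arctan √a)) := by
  have hs := Real.sqrt_pos.2 ha
  have h1 : Tendsto (fun M : ℕ => (M : ℝ) / √a) atTop atTop :=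
    tendsto_natCast_atTop_atTop.atTop_div_const hs
  have h2 := (((Real.tendsto_arctan_atTop.mono_right nhdsWithin_le_nhds).comp h1).sub_const
    (Real.arctan (1 / √a))).const_mul √a
  have h3 : √a * Real.arctan √a = √a * (Real.pi / 2 - Real.arctan (1 / √a)) := by
    rw [one_div, Real.arctan_inv_of_pos hs, sub_sub_cancel]
  rw [h3]
  exact h2

lemma integral_windowExponent {a : ℝ} (ha : 0 < a) {i : ℕ} (hi : 0 < i) (M : ℕ) :
    ∫ u in (i : ℝ)..(M * i : ℕ), a * i ^ 2 / (u ^ 2 + a * i ^ 2) = i * windowExponent a M := by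
  have hs := Real.sqrt_pos.2 ha
  have hss := Real.sq_sqrt ha.le
  have hi' : (0 : ℝ) < i := by exact_mod_cast hi
  rw [intervalIntegral.integral_eq_sub_of_hasDerivAt
    (f := fun u => √a * i * Real.arctan (u / (√a * i)))]
  · unfold windowExponent
    push_cast
    have e1 : (M * i : ℝ) / (√a * i) = M / √a := by field_simp
    have e2 : (i : ℝ) / (√a * i) = 1 / √a := by field_simp
    rw [e1, e2]; ring
  · intro u _
    have := (((hasDerivAt_id u).div_const (√a * i)).arctan).const_mul (√a * i)
    refine this.congr_deriv ?_
    simp only [id_eq]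
    have : 0 < u ^ 2 + a * i ^ 2 := by positivity
    field_simp
    rw [hss]
    ring
  · refine Continuous.intervalIntegrable (continuous_const.div (by fun_prop) fun u => ?_) _ _
    positivity

/-- The integrand decreases, so the sum over right endpoints and the integral differ by at most f(i)
- f(Mi) ≤ f(i) ≤ 1. Uniformity in `i` matters: the error is later multiplied by λπD, whatever the
serving cell. -/
lemma abs_sum_sub_windowExponent_le {a : ℝ} (ha : 0 < a) (i : ℕ) {M : ℕ} (hM : 1 ≤ M) :
    |∑ x ∈ Finset.range (M * i - i), (1 - rayleighLT a (i / (i + 1 + x : ℕ))) -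
      i * windowExponent a M| ≤ 1 := by
  rcases Nat.eq_zero_or_pos i with rfl | hi
  · simp
  have hi' : (0 : ℝ) < i := by exact_mod_cast hi
  have hle : i ≤ M * i := Nat.le_mul_of_pos_left i hM
  set f : ℝ → ℝ := fun u => a * i ^ 2 / (u ^ 2 + a * i ^ 2) with hf
  have hanti : AntitoneOn f (Icc (i : ℝ) (M * i : ℕ)) := by
    intro u hu v hv huv
    have : 0 ≤ u := hi'.le.trans hu.1
    simp only [hf]
    gcongr
  have h1 := hanti.sum_le_integral_Ico hle
  have h2 := hanti.integral_le_sum_Ico hle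
  rw [integral_windowExponent ha hi] at h1 h2
  have hsum : ∑ x ∈ Finset.range (M * i - i), (1 - rayleighLT a (i / (i + 1 + x : ℕ))) =
      ∑ k ∈ Finset.Ico i (M * i), f (k + 1 : ℕ) := by
    rw [Finset.sum_Ico_eq_sum_range]
    refine Finset.sum_congr rfl fun x _ => ?_
    have : (0 : ℝ) < i + 1 + x := by positivity
    simp only [rayleighLT, hf]
    push_cast
    rw [show (i : ℝ) + x + 1 = i + 1 + x by ring]
    field_simp
    ring
  rw [hsum, abs_le]
  have htel : ∑ k ∈ Finset.Ico i (M * i), f k - ∑ k ∈ Finset.Ico i (M * i), f (k + 1 : ℕ) =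
      f i - f (M * i : ℕ) := by
    rw [← Finset.sum_sub_distrib]
    have := Finset.sum_Ico_sub (fun k : ℕ => -f k) hle
    simpa [sub_eq_add_neg, add_comm] using this
  have f0 : ∀ u, 0 ≤ f u := fun u => by simp only [hf]; positivity
  have f1 : f i ≤ 1 := by
    simp only [hf]
    rw [div_le_one (by positivity)]
    nlinarith
  have := f0 (M * i : ℕ)
  constructor <;> linarith

/-! ### Poisson expectations -/

/-- The Poisson generating function, from which each later cell contributes an exponential. -/
lemma hasSum_poisson_pow (r x : ℝ) :
    HasSum (fun n : ℕ => Real.exp (-r) * r ^ n / n.factorial * x ^ n)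
      (Real.exp (-(r * (1 - x)))) := by
  have h := (NormedSpace.expSeries_div_hasSum_exp (r * x)).mul_left (Real.exp (-r))
  rw [← Real.exp_eq_exp_ℝ, ← Real.exp_add] at h
  rw [show -(r * (1 - x)) = -r + r * x by ring]
  refine h.congr_fun fun n => ?_
  rw [mul_pow]; ring

lemma hasSum_poisson (r : ℝ) :
    HasSum (fun n : ℕ => Real.exp (-r) * r ^ n / n.factorial) 1 := by
  simpa using hasSum_poisson_pow r 1

lemma hasSum_poisson_zero (r : ℝ) :
    HasSum (fun n : ℕ => Real.exp (-r) * r ^ n / n.factorial *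
      (if (n : ℕ∞) = 0 then 1 else 0)) (Real.exp (-r)) := by
  convert hasSum_ite_eq 0 (Real.exp (-r)) using 2 with n
  by_cases hn : n = 0 <;> simp [hn]

lemma hasSum_poisson_ne_zero (r : ℝ) :
    HasSum (fun n : ℕ => Real.exp (-r) * r ^ n / n.factorial *
      (if (n : ℕ∞) = 0 then 0 else 1)) (1 - Real.exp (-r)) := by
  refine ((hasSum_poisson r).sub (hasSum_poisson_zero r)).congr_fun fun n => ?_
  by_cases hn : n = 0 <;> simp [hn]

lemma hasSum_poisson_one_lt (r : ℝ) :
    HasSum (fun n : ℕ => Real.exp (-r) * r ^ n / n.factorial *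
      (if (n : ℕ∞) ≤ 1 then 0 else 1)) (1 - Real.exp (-r) - r * Real.exp (-r)) := by
  refine ((hasSum_poisson_ne_zero r).sub (hasSum_ite_eq 1 (r * Real.exp (-r)))).congr_fun
    fun n => ?_
  rcases n with _ | _ | n
  · simp
  · simp; ring
  · have : ¬ ((n + 1 + 1 : ℕ) : ℕ∞) ≤ 1 := by
      exact_mod_cast (by omega : ¬ n + 1 + 1 ≤ 1)
    simp only [this, if_false]
    simp

/-! ### Discs and cells -/

/-- Disc of squared radius `t` about the origin. -/
def disc (t : ℝ) : Set Plane := {x | ‖x‖ ^ 2 ≤ t}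

/-- Annulus of the points whose squared norm lies in the `j`-th cell of mesh `D`. -/
def cell (D : ℝ) (j : ℕ) : Set Plane := {x | cellIdx D (‖x‖ ^ 2) = j}

lemma disc_eq_closedBall {t : ℝ} (ht : 0 ≤ t) : disc t = Metric.closedBall 0 √t := by
  ext x
  simp [disc, Real.le_sqrt (norm_nonneg x) ht]

lemma measurableSet_disc (t : ℝ) : MeasurableSet (disc t) :=
  measurableSet_le (by fun_prop) (by fun_prop)

lemma isBounded_disc {t : ℝ} (ht : 0 ≤ t) : Bornology.IsBounded (disc t) := by
  rw [disc_eq_closedBall ht]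
  exact Metric.isBounded_closedBall

lemma volume_disc {t : ℝ} (ht : 0 ≤ t) : volume (disc t) = ENNReal.ofReal (Real.pi * t) := by
  rw [disc_eq_closedBall ht, EuclideanSpace.volume_closedBall_fin_two,
    ← ENNReal.ofReal_pow (Real.sqrt_nonneg t), Real.sq_sqrt ht, ← ENNReal.ofReal_mul ht, mul_comm]

lemma measurable_cellIdx (D : ℝ) : Measurable (cellIdx D) :=
  Nat.measurable_ceil.comp (measurable_id.div_const D)

lemma measurableSet_cell (D : ℝ) (j : ℕ) : MeasurableSet (cell D j) :=
  (measurable_cellIdx D).comp (by fun_prop : Measurable fun x : Plane => ‖x‖ ^ 2)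
    (measurableSet_singleton j)

/-- Because of the ceiling, cell 0 is only the origin and has area 0, unlike all the others. -/
lemma cell_zero {D : ℝ} (hD : 0 < D) : cell D 0 = disc 0 := by
  ext x
  simp only [cell, disc, cellIdx, mem_ofPred_eq, Nat.ceil_eq_zero, div_le_iff₀ hD, zero_mul]

lemma cell_succ {D : ℝ} (hD : 0 < D) (j : ℕ) :
    cell D (j + 1) = disc ((j + 1 : ℕ) * D) \ disc (j * D) := by
  ext x
  simp only [cell, disc, cellIdx, mem_ofPred_eq, Set.mem_sdiff, ← div_le_iff₀ hD, ← Nat.ceil_le]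
  omega

lemma cell_subset_disc {D : ℝ} (hD : 0 < D) (j : ℕ) : cell D j ⊆ disc (j * D) := by
  rintro x rfl
  have := le_mul_cellIdx hD (‖x‖ ^ 2)
  rwa [mul_comm] at this

lemma isBounded_cell {D : ℝ} (hD : 0 < D) (j : ℕ) : Bornology.IsBounded (cell D j) :=
  (isBounded_disc (by positivity)).subset (cell_subset_disc hD j)

lemma volume_cell_succ {D : ℝ} (hD : 0 < D) (j : ℕ) :
    volume (cell D (j + 1)) = ENNReal.ofReal (Real.pi * D) := by
  have hsub : disc (j * D) ⊆ disc ((j + 1 : ℕ) * D) := by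
    intro x hx
    have : (j : ℝ) * D ≤ (j + 1 : ℕ) * D := by gcongr; simp
    exact le_trans hx this
  have h0 : 0 ≤ (j : ℝ) * D := by positivity
  rw [cell_succ hD, measure_sdiff hsub (measurableSet_disc _).nullMeasurableSet
    (by rw [volume_disc h0]; exact ENNReal.ofReal_ne_top), volume_disc h0,
    volume_disc (by positivity), ← ENNReal.ofReal_sub _ (by positivity)]
  congr 1
  push_cast
  ring

/-! ### Locating the serving station through cell counts -/

section Counting

variable {Ω : Type*} {X : ℕ → Ω → Plane}

/-- The serving base station lies in the `i`-th cell. -/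
def servingCell (X : ℕ → Ω → Plane) (D : ℝ) (i : ℕ) : Set Ω := {ω | cellIdx D (‖X 0 ω‖ ^ 2) = i}

lemma iUnion_servingCell (X : ℕ → Ω → Plane) (D : ℝ) : ⋃ i, servingCell X D i = univ := by
  ext ω; simp [servingCell]

lemma pairwise_disjoint_servingCell (X : ℕ → Ω → Plane) (D : ℝ) :
    Pairwise (Function.onFun Disjoint (servingCell X D)) := by
  intro i j hij
  refine Set.disjoint_left.2 fun ω h1 h2 => hij ?_
  exact h1.symm.trans h2

lemma count_eq_zero_iff {B : Set Plane} {ω : Ω} : count X B ω = 0 ↔ ∀ n, X n ω ∉ B := by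
  simp [count, Set.encard_eq_zero, Set.eq_empty_iff_forall_notMem]

/-- By the ordering, every other point lies in the same cell as `X 0` or a later one. The serving
cell thus becomes an event about counts, to which the independence of the process applies. -/
lemma mem_servingCell_iff {D : ℝ} (hD : 0 < D) {i : ℕ} {ω : Ω}
    (hω : Monotone fun n => ‖X n ω‖) : ω ∈ servingCell X D i ↔
      (∀ j < i, count X (cell D j) ω = 0) ∧ count X (cell D i) ω ≠ 0 := by
  have hmono : ∀ n, cellIdx D (‖X 0 ω‖ ^ 2) ≤ cellIdx D (‖X n ω‖ ^ 2) := fun n =>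
    cellIdx_mono hD (pow_le_pow_left₀ (norm_nonneg _) (hω (Nat.zero_le n)) 2)
  simp only [servingCell, mem_ofPred_eq, Ne, count_eq_zero_iff, cell]
  constructor
  · rintro rfl
    exact ⟨fun j hj n hn => by have := hmono n; omega, fun h => h 0 rfl⟩
  · rintro ⟨h1, h2⟩
    push Not at h2
    obtain ⟨n, hn⟩ := h2
    have := hmono n
    by_contra hne
    exact h1 (cellIdx D (‖X 0 ω‖ ^ 2)) (by omega) 0 rfl

/-- Factor of the `j`-th cell: the cells before `i` are empty, the `i`-th cell is hit, and the later
cells contribute powers of `φ`. -/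
noncomputable def cellFactor (i : ℕ) (φ : ℕ → ℝ) (j : ℕ) (N : ℕ∞) : ℝ :=
  if j < i then (if N = 0 then 1 else 0) else if j = i then (if N = 0 then 0 else 1)
    else φ (j - (i + 1)) ^ N.toNat

lemma prod_cellFactor (i m : ℕ) (φ : ℕ → ℝ) {D : ℝ} (hD : 0 < D) {ω : Ω}
    (hω : Monotone fun n => ‖X n ω‖) :
    ∏ j ∈ Finset.range (i + 1 + m), cellFactor i φ j (count X (cell D j) ω) =
      (servingCell X D i).indicator
        (fun ω => ∏ x ∈ Finset.range m, φ x ^ (count X (cell D (i + 1 + x)) ω).toNat) ω := by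
  classical
  rw [Finset.prod_range_add, Finset.prod_range_succ]
  have e1 : ∏ j ∈ Finset.range i, cellFactor i φ j (count X (cell D j) ω) =
      if ∀ j < i, count X (cell D j) ω = 0 then 1 else 0 := by
    rw [← Finset.prod_congr rfl (g := fun j => cellFactor i φ j (count X (cell D j) ω))
      (f := fun j => if count X (cell D j) ω = 0 then (1 : ℝ) else 0)]
    · rw [Finset.prod_ite_zero]
      simp
    · intro j hj
      simp [cellFactor, Finset.mem_range.1 hj]
  have e2 : ∀ x, cellFactor i φ (i + 1 + x) (count X (cell D (i + 1 + x)) ω) =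
      φ x ^ (count X (cell D (i + 1 + x)) ω).toNat := by
    intro x
    have h1 : ¬ i + 1 + x < i := by omega
    have h2 : ¬ i + 1 + x = i := by omega
    simp only [cellFactor, h1, h2, if_false, Nat.add_sub_cancel_left]
  have e3 : cellFactor i φ i (count X (cell D i) ω) =
      if count X (cell D i) ω = 0 then 0 else 1 := by simp [cellFactor]
  rw [e1, e3, Finset.prod_congr rfl fun x _ => e2 x]
  have hiff := mem_servingCell_iff (i := i) hD hω
  by_cases h : ω ∈ servingCell X D i
  · rw [indicator_of_mem h, if_pos (hiff.1 h).1, if_neg (hiff.1 h).2]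
    simp
  · rw [indicator_of_notMem h]
    by_cases h1 : ∀ j < i, count X (cell D j) ω = 0
    · have : count X (cell D i) ω = 0 := by
        by_contra h2; exact h (hiff.2 ⟨h1, h2⟩)
      simp [this]
    · simp [h1]

end Counting

/-! ### Independence across cells and almost sure properties of the process -/

section PPP

variable {Ω : Type*} [MeasurableSpace Ω] {μ : Measure Ω} {lam : ℝ} {X : ℕ → Ω → Plane}

lemma IsPPP.integral_count (hX : IsPPP μ lam X) (hlam : 0 ≤ lam) {B : Set Plane}
    (hB : MeasurableSet B) (hb : Bornology.IsBounded B) {v : ℝ} (hv0 : 0 ≤ v)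
    (hv : volume B = ENNReal.ofReal v) (f : ℕ∞ → ℝ) {S : ℝ}
    (hS : HasSum (fun n : ℕ =>
      Real.exp (-(lam * v)) * (lam * v) ^ n / n.factorial * f n) S) :
    ∫ ω, f (count X B ω) ∂μ = S := by
  have h1 := (hX.count_law B hB hb).integral_comp (f := f)
    (Measurable.of_discrete.aestronglyMeasurable)
  have h2 : ((ENNReal.ofReal lam * volume B).toNNReal : ℝ) = lam * v := by
    rw [hv, ← ENNReal.ofReal_mul hlam]
    exact ENNReal.toReal_ofReal (by positivity)
  simp only [Function.comp_def] at h1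
  rw [h1, integral_map_cast_poissonMeasure, h2]
  simpa using hS.tsum_eq

lemma IsPPP.ae_count_ne_top (hX : IsPPP μ lam X) {B : Set Plane}
    (hB : MeasurableSet B) (hb : Bornology.IsBounded B) : ∀ᵐ ω ∂μ, count X B ω ≠ ⊤ := by
  rw [(hX.count_law B hB hb).ae_iff (p := fun N => N ≠ ⊤) Measurable.of_discrete,
    ae_map_iff Measurable.of_discrete.aemeasurable (MeasurableSet.of_discrete)]
  simp

lemma IsPPP.integral_prod_count (hX : IsPPP μ lam X) {D : ℝ} (hD : 0 < D) (m : ℕ)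
    (f : ℕ → ℕ∞ → ℝ) :
    ∫ ω, ∏ j ∈ Finset.range m, f j (count X (cell D j) ω) ∂μ =
      ∏ j ∈ Finset.range m, ∫ ω, f j (count X (cell D j) ω) ∂μ := by
  simp_rw [Finset.prod_range]
  refine (hX.count_indep m (fun j => cell D j) (fun j => measurableSet_cell D j)
    (fun j => isBounded_cell hD j) ?_).integral_fun_prod_comp
    (f := fun (j : Fin m) N => f j N)
    (fun j => (hX.count_law _ (measurableSet_cell D j) (isBounded_cell hD j)).aemeasurable)
    (fun j => Measurable.of_discrete.aestronglyMeasurable)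
  intro i j hij
  rw [Set.disjoint_left]
  intro x hx hx'
  exact hij (Fin.ext (hx.symm.trans hx'))

lemma IsPPP.measurable_cellIdx (hX : IsPPP μ lam X) (D : ℝ) (n : ℕ) :
    Measurable fun ω => cellIdx D (‖X n ω‖ ^ 2) :=
  (Cellular.measurable_cellIdx D).comp (by have := hX.measurable n; fun_prop)

lemma IsPPP.measurableSet_servingCell (hX : IsPPP μ lam X) (D : ℝ) (i : ℕ) :
    MeasurableSet (servingCell X D i) := hX.measurable_cellIdx D 0 (measurableSet_singleton i)

lemma IsPPP.integral_indicator_servingCell (hX : IsPPP μ lam X)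
    (ho : ∀ᵐ ω ∂μ, Monotone fun n => ‖X n ω‖) {D : ℝ} (hD : 0 < D) (i m : ℕ) (φ : ℕ → ℝ) :
    ∫ ω in servingCell X D i,
        ∏ x ∈ Finset.range m, φ x ^ (count X (cell D (i + 1 + x)) ω).toNat ∂μ =
      ∏ j ∈ Finset.range (i + 1 + m), ∫ ω, cellFactor i φ j (count X (cell D j) ω) ∂μ := by
  rw [← integral_indicator (hX.measurableSet_servingCell D i), ← hX.integral_prod_count hD]
  refine integral_congr_ae ?_
  filter_upwards [ho] with ω hω
  exact (prod_cellFactor i m φ hD hω).symm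

/-- No cell beyond `i` enters, so `φ` is arbitrary; this lets the product be recognised as the
leading part of a longer one with any `φ`. -/
lemma IsPPP.measureReal_servingCell (hX : IsPPP μ lam X)
    (ho : ∀ᵐ ω ∂μ, Monotone fun n => ‖X n ω‖) {D : ℝ} (hD : 0 < D) (i : ℕ) (φ : ℕ → ℝ) :
    μ.real (servingCell X D i) =
      ∏ j ∈ Finset.range (i + 1), ∫ ω, cellFactor i φ j (count X (cell D j) ω) ∂μ := by
  simpa using hX.integral_indicator_servingCell ho hD i 0 φ

/-- The counts beyond cell `i` are independent of the event, and each has mean λπD and generating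
function exp(-λπD (1 - φ x)). -/
lemma IsPPP.setIntegral_servingCell (hX : IsPPP μ lam X) (hlam : 0 ≤ lam)
    (ho : ∀ᵐ ω ∂μ, Monotone fun n => ‖X n ω‖) {D : ℝ} (hD : 0 < D) (i m : ℕ) (φ : ℕ → ℝ) :
    ∫ ω in servingCell X D i,
        ∏ x ∈ Finset.range m, φ x ^ (count X (cell D (i + 1 + x)) ω).toNat ∂μ =
      μ.real (servingCell X D i) *
        Real.exp (-(lam * (Real.pi * D) * ∑ x ∈ Finset.range m, (1 - φ x))) := by
  rw [hX.integral_indicator_servingCell ho hD, Finset.prod_range_add,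
    ← hX.measureReal_servingCell ho hD, Finset.mul_sum, ← Finset.sum_neg_distrib, Real.exp_sum]
  congr 1
  refine Finset.prod_congr rfl fun x _ => ?_
  have h1 : ¬ i + 1 + x < i := by omega
  have h2 : ¬ i + 1 + x = i := by omega
  simp only [cellFactor, h1, h2, if_false, Nat.add_sub_cancel_left]
  have hv : volume (cell D (i + 1 + x)) = ENNReal.ofReal (Real.pi * D) := by
    rw [show i + 1 + x = i + x + 1 by ring]; exact volume_cell_succ hD _
  exact hX.integral_count hlam (measurableSet_cell D _) (isBounded_cell hD _)
    (by positivity) hv (fun N => φ x ^ N.toNat) (by simpa using hasSum_poisson_pow _ (φ x))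

/-- For a Poisson N of mean m, P(N ≥ 2) ≤ m P(N ≥ 1) amounts to 1 - m ≤ e^{-m}. Keeping the factor
P(N ≥ 1) allows summation over all cells against the probabilities of the serving cell. -/
lemma IsPPP.integral_one_lt_le (hX : IsPPP μ lam X) (hlam : 0 ≤ lam) {D : ℝ} (hD : 0 < D) (i : ℕ) :
    ∫ ω, (if count X (cell D i) ω ≤ 1 then 0 else 1 : ℝ) ∂μ ≤
      lam * (Real.pi * D) * ∫ ω, (if count X (cell D i) ω = 0 then 0 else 1 : ℝ) ∂μ := by
  rcases i with _ | i
  · have hv : volume (cell D 0) = ENNReal.ofReal 0 := by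
      rw [cell_zero hD, volume_disc le_rfl, mul_zero]
    rw [hX.integral_count hlam (measurableSet_cell D _) (isBounded_cell hD _) le_rfl hv
      (fun N => if N ≤ 1 then 0 else 1) (hasSum_poisson_one_lt _),
      hX.integral_count hlam (measurableSet_cell D _) (isBounded_cell hD _) le_rfl hv
      (fun N => if N = 0 then 0 else 1) (hasSum_poisson_ne_zero _)]
    simp
  · have hp : 0 ≤ Real.pi * D := by positivity
    rw [hX.integral_count hlam (measurableSet_cell D _) (isBounded_cell hD _) hp
      (volume_cell_succ hD i) (fun N => if N ≤ 1 then 0 else 1) (hasSum_poisson_one_lt _),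
      hX.integral_count hlam (measurableSet_cell D _) (isBounded_cell hD _) hp
      (volume_cell_succ hD i) (fun N => if N = 0 then 0 else 1) (hasSum_poisson_ne_zero _)]
    have := Real.one_sub_le_exp_neg (lam * (Real.pi * D))
    nlinarith

/-- Two points share the cell of the serving base station with small probability. -/
lemma IsPPP.measure_same_cell_le [IsProbabilityMeasure μ] (hX : IsPPP μ lam X) (hlam : 0 ≤ lam)
    (ho : ∀ᵐ ω ∂μ, Monotone fun n => ‖X n ω‖) {D : ℝ} (hD : 0 < D) :
    μ {ω | cellIdx D (‖X 0 ω‖ ^ 2) = cellIdx D (‖X 1 ω‖ ^ 2)} ≤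
      ENNReal.ofReal (lam * (Real.pi * D)) := by
  set A : ℕ → Set Ω := fun i => servingCell X D i ∩ {ω | cellIdx D (‖X 1 ω‖ ^ 2) = i} with hA
  have hAm : ∀ i, MeasurableSet (A i) := fun i =>
    (hX.measurableSet_servingCell D i).inter (hX.measurable_cellIdx D 1 (measurableSet_singleton i))
  have hsub : {ω | cellIdx D (‖X 0 ω‖ ^ 2) = cellIdx D (‖X 1 ω‖ ^ 2)} ⊆ ⋃ i, A i := by
    intro ω hω
    exact mem_iUnion.2 ⟨_, rfl, Eq.symm hω⟩
  have hm0 : 0 ≤ lam * (Real.pi * D) := by positivity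
  have hAi : ∀ i, μ (A i) ≤ ENNReal.ofReal (lam * (Real.pi * D)) * μ (servingCell X D i) := by
    intro i
    rw [← ofReal_measureReal, ← ofReal_measureReal (s := servingCell X D i),
      ← ENNReal.ofReal_mul hm0]
    refine ENNReal.ofReal_le_ofReal ?_
    -- On `A i` the cells before `i` are empty and cell `i` holds at least two points; compared with
    -- the serving-cell event, only the last factor changes.
    let f : ℕ → ℕ∞ → ℝ := fun j N =>
      if j < i then (if N = 0 then 1 else 0) else (if N ≤ 1 then 0 else 1)
    have hle : μ.real (A i) ≤ ∫ ω, ∏ j ∈ Finset.range (i + 1), f j (count X (cell D j) ω) ∂μ := by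
      rw [← integral_indicator_one (hAm i)]
      refine integral_mono_of_nonneg (ae_of_all _ fun ω => indicator_nonneg (by simp) ω) ?_ ?_
      · refine Integrable.of_bound (C := 1) ?_ (ae_of_all _ fun ω => ?_)
        · refine AEMeasurable.aestronglyMeasurable ?_
          refine Finset.aemeasurable_fun_prod _ fun j _ => ?_
          exact (Measurable.of_discrete (f := f j)).comp_aemeasurable
            (hX.count_law _ (measurableSet_cell D j) (isBounded_cell hD j)).aemeasurable
        · rw [Real.norm_eq_abs, Finset.abs_prod]
          refine Finset.prod_le_one (fun _ _ => abs_nonneg _) fun j _ => ?_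
          simp only [f]
          split_ifs <;> simp
      · filter_upwards [ho] with ω hω
        by_cases hω' : ω ∈ A i
        · rw [indicator_of_mem hω']
          have h1 := (mem_servingCell_iff hD hω).1 hω'.1
          have h2 : ¬ count X (cell D i) ω ≤ 1 := by
            rw [count, Set.encard_le_one_iff]
            intro h
            exact zero_ne_one (h 0 1 hω'.1 hω'.2)
          rw [Finset.prod_eq_one]
          · simp
          · intro j hj
            rcases lt_or_eq_of_le (Nat.lt_succ_iff.1 (Finset.mem_range.1 hj)) with h | rfl
            · simp [f, h, h1.1 j h]
            · simp [f, h2]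
        · rw [indicator_of_notMem hω']
          refine Finset.prod_nonneg fun j _ => ?_
          simp only [f]
          split_ifs <;> simp
    refine hle.trans ?_
    rw [hX.integral_prod_count hD, hX.measureReal_servingCell ho hD i 0, Finset.prod_range_succ,
      Finset.prod_range_succ, mul_left_comm]
    have e1 : ∏ j ∈ Finset.range i, ∫ ω, f j (count X (cell D j) ω) ∂μ =
        ∏ j ∈ Finset.range i, ∫ ω, cellFactor i 0 j (count X (cell D j) ω) ∂μ := by
      refine Finset.prod_congr rfl fun j hj => ?_
      simp [f, cellFactor, Finset.mem_range.1 hj]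
    rw [e1]
    refine mul_le_mul_of_nonneg_left ?_ (Finset.prod_nonneg fun j hj => ?_)
    · simpa [f, cellFactor] using hX.integral_one_lt_le hlam hD i
    · simp only [cellFactor, Finset.mem_range.1 hj, if_true]
      exact integral_nonneg fun ω => by dsimp only; split_ifs <;> simp
  calc _ ≤ μ (⋃ i, A i) := measure_mono hsub
    _ ≤ ∑' i, μ (A i) := measure_iUnion_le _
    _ ≤ ∑' i, ENNReal.ofReal (lam * (Real.pi * D)) * μ (servingCell X D i) :=
        ENNReal.tsum_le_tsum hAi
    _ = _ := by
        rw [ENNReal.tsum_mul_left, ← measure_iUnion (pairwise_disjoint_servingCell X D)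
          (hX.measurableSet_servingCell D), iUnion_servingCell, measure_univ, mul_one]

/-- Equal norms share a cell for every mesh, and the probability of sharing one is O(D). -/
lemma IsPPP.ae_norm_lt [IsProbabilityMeasure μ] (hX : IsPPP μ lam X) (hlam : 0 ≤ lam)
    (ho : ∀ᵐ ω ∂μ, Monotone fun n => ‖X n ω‖) : ∀ᵐ ω ∂μ, ‖X 0 ω‖ ^ 2 < ‖X 1 ω‖ ^ 2 := by
  have hz : μ {ω | ‖X 0 ω‖ ^ 2 = ‖X 1 ω‖ ^ 2} = 0 := by
    refine le_antisymm (ge_of_tendsto' (f := fun n : ℕ =>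
      ENNReal.ofReal (lam * (Real.pi * (1 / ((n : ℝ) + 1))))) (x := atTop) ?_ fun n => ?_) zero_le
    · rw [← ENNReal.ofReal_zero]
      refine ENNReal.tendsto_ofReal ?_
      simpa using (tendsto_one_div_add_atTop_nhds_zero_nat (𝕜 := ℝ)).const_mul Real.pi
        |>.const_mul lam
    · refine le_trans (measure_mono ?_) (hX.measure_same_cell_le hlam ho (by positivity))
      intro ω hω
      exact congrArg _ hω
  have hz' : ∀ᵐ ω ∂μ, ‖X 0 ω‖ ^ 2 ≠ ‖X 1 ω‖ ^ 2 := by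
    rw [ae_iff]; simpa using hz
  filter_upwards [hz', ho] with ω h1 h2
  exact lt_of_le_of_ne (pow_le_pow_left₀ (norm_nonneg _) (h2 zero_le_one) 2) h1

/-- Each disc holds finitely many indices almost surely, so a monotone sequence of norms cannot stay
bounded. -/
lemma IsPPP.ae_tendsto_norm (hX : IsPPP μ lam X)
    (ho : ∀ᵐ ω ∂μ, Monotone fun n => ‖X n ω‖) :
    ∀ᵐ ω ∂μ, Tendsto (fun n => ‖X n ω‖ ^ 2) atTop atTop := by
  have h1 : ∀ R : ℕ, ∀ᵐ ω ∂μ, count X (disc R) ω ≠ ⊤ := fun R =>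
    hX.ae_count_ne_top (measurableSet_disc _) (isBounded_disc (Nat.cast_nonneg R))
  filter_upwards [ae_all_iff.2 h1, ho] with ω hω hmono
  have hm : Monotone fun n => ‖X n ω‖ ^ 2 := fun a b hab =>
    pow_le_pow_left₀ (norm_nonneg _) (hmono hab) 2
  refine tendsto_atTop_atTop_of_monotone hm fun b => ?_
  obtain ⟨R, hR⟩ := exists_nat_ge b
  by_contra! hcon
  refine hω R ?_
  have : {n : ℕ | X n ω ∈ disc R} = univ :=
    eq_univ_of_forall fun n => (hcon n).le.trans hR
  rw [count, this]
  simp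

/-! ### Law of the service distance -/

/-- The nearest point lies in a disc exactly when the disc is not empty, so this is the void
probability. -/
lemma IsPPP.measureReal_norm_sq_le [IsProbabilityMeasure μ] (hX : IsPPP μ lam X) (hlam : 0 ≤ lam)
    (ho : ∀ᵐ ω ∂μ, Monotone fun n => ‖X n ω‖) {t : ℝ} (ht : 0 ≤ t) :
    μ.real {ω | ‖X 0 ω‖ ^ 2 ≤ t} = 1 - Real.exp (-(lam * (Real.pi * t))) := by
  have hm : MeasurableSet {ω | ‖X 0 ω‖ ^ 2 ≤ t} := by
    have := hX.measurable 0
    exact measurableSet_le (by fun_prop) (by fun_prop)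
  rw [← integral_indicator_one hm, ← hX.integral_count hlam (measurableSet_disc t)
    (isBounded_disc ht) (by positivity) (volume_disc ht) (fun N => if N = 0 then 0 else 1)
    (hasSum_poisson_ne_zero _)]
  refine integral_congr_ae ?_
  filter_upwards [ho] with ω hω
  by_cases h : ‖X 0 ω‖ ^ 2 ≤ t
  · have h2 : count X (disc t) ω ≠ 0 := fun h0 => count_eq_zero_iff.1 h0 0 h
    rw [indicator_of_mem (show ω ∈ {ω | ‖X 0 ω‖ ^ 2 ≤ t} from h)]
    simp [h2]
  · have h2 : count X (disc t) ω = 0 := by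
      refine count_eq_zero_iff.2 fun n hn => h ?_
      exact (pow_le_pow_left₀ (norm_nonneg _) (hω (Nat.zero_le n)) 2).trans hn
    rw [indicator_of_notMem (show ω ∉ {ω | ‖X 0 ω‖ ^ 2 ≤ t} from h)]
    simp [h2]

lemma IsPPP.ae_norm_pos [IsProbabilityMeasure μ] (hX : IsPPP μ lam X) (hlam : 0 ≤ lam)
    (ho : ∀ᵐ ω ∂μ, Monotone fun n => ‖X n ω‖) : ∀ᵐ ω ∂μ, 0 < ‖X 0 ω‖ := by
  have h := hX.measureReal_norm_sq_le hlam ho le_rfl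
  simp only [mul_zero, neg_zero, Real.exp_zero, sub_self] at h
  rw [measureReal_eq_zero_iff] at h
  have h' : ∀ᵐ ω ∂μ, ¬ ‖X 0 ω‖ ^ 2 ≤ 0 := by rw [ae_iff]; simpa using h
  filter_upwards [h'] with ω hω
  by_contra h0
  exact hω (by rw [le_antisymm (not_lt.1 h0) (norm_nonneg _)]; simp)

lemma IsPPP.map_serviceDist [IsProbabilityMeasure μ] (hX : IsPPP μ lam X) (hlam : 0 < lam)
    (ho : ∀ᵐ ω ∂μ, Monotone fun n => ‖X n ω‖) :
    μ.map (serviceDist X) = (volume.restrict (Ioi (0 : ℝ))).withDensity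
      (fun r => ENNReal.ofReal (2 * Real.pi * lam * r * Real.exp (-(Real.pi * lam * r ^ 2)))) := by
  have hXm := hX.measurable 0
  have hsm : Measurable (serviceDist X) := by unfold serviceDist; fun_prop
  have : IsProbabilityMeasure (μ.map (serviceDist X)) :=
    Measure.isProbabilityMeasure_map hsm.aemeasurable
  refine Measure.ext_of_Iic _ _ fun t => ?_
  rw [withDensity_apply _ measurableSet_Iic, Measure.restrict_restrict measurableSet_Iic,
    Measure.map_apply hsm measurableSet_Iic, Iic_inter_Ioi]
  rcases lt_or_ge t 0 with ht | ht
  · rw [Ioc_eq_empty (by linarith), Measure.restrict_empty, lintegral_zero_measure]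
    have : serviceDist X ⁻¹' Iic t = ∅ := by
      ext ω
      simp only [mem_preimage, mem_Iic, mem_empty_iff_false, iff_false, not_le, serviceDist]
      exact ht.trans_le (norm_nonneg _)
    rw [this, measure_empty]
  · have hset : serviceDist X ⁻¹' Iic t = {ω | ‖X 0 ω‖ ^ 2 ≤ t ^ 2} := by
      ext ω
      simp only [mem_preimage, mem_Iic, mem_ofPred_eq, serviceDist]
      exact (pow_le_pow_iff_left₀ (norm_nonneg _) ht two_ne_zero).symm
    rw [hset, ← ofReal_measureReal, hX.measureReal_norm_sq_le hlam.le ho (by positivity)]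
    have hcont : Continuous fun r : ℝ =>
        2 * Real.pi * lam * r * Real.exp (-(Real.pi * lam * r ^ 2)) := by fun_prop
    rw [← ofReal_integral_eq_lintegral_ofReal
      (hcont.integrableOn_Icc.mono_set Ioc_subset_Icc_self)]
    · rw [← intervalIntegral.integral_of_le ht, intervalIntegral.integral_eq_sub_of_hasDerivAt
        (f := fun r => -Real.exp (-(Real.pi * lam * r ^ 2))) _ (hcont.intervalIntegrable _ _)]
      · congr 1
        simp only [ne_eq, OfNat.ofNat_ne_zero, not_false_eq_true, zero_pow, mul_zero, neg_zero,
          Real.exp_zero]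
        ring_nf
      · intro r _
        have := (((hasDerivAt_pow 2 r).const_mul (Real.pi * lam)).neg.exp).neg
        refine HasDerivAt.congr_deriv this ?_
        simp only [Pi.neg_apply, Nat.cast_ofNat, Nat.add_one_sub_one, pow_one]
        ring
    · filter_upwards [ae_restrict_mem measurableSet_Ioc] with r hr
      have := hr.1
      have := Real.pi_pos
      simp only [Pi.zero_apply]
      positivity

lemma IsPPP.integral_serviceDist [IsProbabilityMeasure μ] (hX : IsPPP μ lam X) (hlam : 0 < lam)
    (ho : ∀ᵐ ω ∂μ, Monotone fun n => ‖X n ω‖) (f : ℝ → ℝ) :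
    ∫ r, f r ∂(μ.map (serviceDist X)) =
      ∫ r in Ioi (0 : ℝ), 2 * Real.pi * lam * r * Real.exp (-(Real.pi * lam * r ^ 2)) * f r := by
  rw [hX.map_serviceDist hlam ho, integral_withDensity_eq_integral_toReal_smul (by fun_prop)
    (ae_of_all _ fun _ => ENNReal.ofReal_lt_top)]
  refine setIntegral_congr_fun measurableSet_Ioi fun r hr => ?_
  have : 0 < r := hr
  have := Real.pi_pos
  simp only [smul_eq_mul]
  rw [ENNReal.toReal_ofReal (by positivity)]

lemma integral_rayleigh_exponent (hlam : 0 < lam) {c : ℝ} (hc : 0 ≤ c) :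
    ∫ r in Ioi (0 : ℝ), 2 * Real.pi * lam * r * Real.exp (-(Real.pi * lam * r ^ 2 * (c + 1))) =
      1 / (1 + c) := by
  have hpi := Real.pi_pos
  have h := integral_Ioi_mul_exp_neg_mul_sq (b := Real.pi * lam * (c + 1)) (by positivity) le_rfl
  have e : ∀ r : ℝ, 2 * Real.pi * lam * r * Real.exp (-(Real.pi * lam * r ^ 2 * (c + 1))) =
      Real.pi * lam * (2 * r * Real.exp (-(Real.pi * lam * (c + 1) * r ^ 2))) := by
    intro r; ring_nf
  simp_rw [e]
  rw [integral_const_mul, h]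
  have : c + 1 ≠ 0 := by positivity
  have : 1 + c ≠ 0 := by positivity
  simp
  field_simp
  ring

lemma IsPPP.integral_exp_neg_norm_sq [IsProbabilityMeasure μ] (hX : IsPPP μ lam X) (hlam : 0 < lam)
    (ho : ∀ᵐ ω ∂μ, Monotone fun n => ‖X n ω‖) {c : ℝ} (hc : 0 ≤ c) :
    ∫ ω, Real.exp (-(lam * Real.pi * ‖X 0 ω‖ ^ 2 * c)) ∂μ = 1 / (1 + c) := by
  have hXm := hX.measurable 0
  have hsm : Measurable (serviceDist X) := by unfold serviceDist; fun_prop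
  rw [← integral_rayleigh_exponent hlam hc]
  have h := hX.integral_serviceDist hlam ho fun r => Real.exp (-(lam * Real.pi * r ^ 2 * c))
  rw [integral_map hsm.aemeasurable (by fun_prop)] at h
  refine h.trans (integral_congr_ae (ae_of_all _ fun r => ?_))
  simp only
  rw [mul_assoc _ (Real.exp _), ← Real.exp_add]
  ring_nf

end PPP

/-! ### The mean product of the fading transforms -/

lemma abs_exp_neg_sub_exp_neg_le {x y : ℝ} (hx : 0 ≤ x) (hy : 0 ≤ y) :
    |Real.exp (-x) - Real.exp (-y)| ≤ |x - y| := by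
  wlog hxy : x ≤ y generalizing x y
  · rw [abs_sub_comm, abs_sub_comm x]
    exact this hy hx (le_of_not_ge hxy)
  have h1 : Real.exp (-y) ≤ Real.exp (-x) := Real.exp_le_exp.2 (by linarith)
  have h2 : Real.exp (-y) = Real.exp (-x) * Real.exp (-(y - x)) := by
    rw [← Real.exp_add]; ring_nf
  have h3 := Real.one_sub_le_exp_neg (y - x)
  have h4 : Real.exp (-x) ≤ 1 := Real.exp_le_one_iff.2 (by linarith)
  have h5 := Real.exp_pos (-x)
  rw [abs_of_nonneg (by linarith), abs_of_nonpos (by linarith)]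
  nlinarith

section

variable {Ω : Type*} {X : ℕ → Ω → Plane}

lemma cellProd_of_mem_servingCell {a D : ℝ} {M i : ℕ} {ω : Ω} (hω : ω ∈ servingCell X D i) :
    cellProd a D M (fun n => ‖X n ω‖ ^ 2) = ∏ x ∈ Finset.range (M * i - i),
      rayleighLT a (i / (i + 1 + x : ℕ)) ^ (count X (cell D (i + 1 + x)) ω).toNat := by
  have hi : cellIdx D (‖X 0 ω‖ ^ 2) = i := hω
  unfold cellProd
  rw [hi]
  rfl

/-- Product of the transforms of the first `n` interferers. -/
noncomputable def fadingProd (X : ℕ → Ω → Plane) (a : ℝ) (n : ℕ) (ω : Ω) : ℝ :=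
  ∏ k ∈ Finset.range n, rayleighLT a (‖X 0 ω‖ ^ 2 / ‖X (k + 1) ω‖ ^ 2)

lemma fadingProd_nonneg {a : ℝ} (ha : 0 ≤ a) (n : ℕ) (ω : Ω) : 0 ≤ fadingProd X a n ω :=
  Finset.prod_nonneg fun _ _ => rayleighLT_nonneg ha _

lemma fadingProd_le_one {a : ℝ} (ha : 0 ≤ a) (n : ℕ) (ω : Ω) : fadingProd X a n ω ≤ 1 :=
  Finset.prod_le_one (fun _ _ => rayleighLT_nonneg ha _) fun _ _ => rayleighLT_le_one ha _

lemma antitone_fadingProd {a : ℝ} (ha : 0 ≤ a) (ω : Ω) :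
    Antitone fun n => fadingProd X a n ω := by
  refine antitone_nat_of_succ_le fun n => ?_
  rw [fadingProd, Finset.prod_range_succ]
  exact mul_le_of_le_one_right (fadingProd_nonneg ha n ω) (rayleighLT_le_one ha _)

end

section

variable {Ω : Type*} [MeasurableSpace Ω] {μ : Measure Ω} {lam : ℝ} {X : ℕ → Ω → Plane}

lemma integral_eq_of_setIntegral_servingCell (hX : IsPPP μ lam X) (D : ℝ) {F G : Ω → ℝ}
    (hF : Integrable F μ) (hG : Integrable G μ)
    (h : ∀ i, ∫ ω in servingCell X D i, F ω ∂μ = ∫ ω in servingCell X D i, G ω ∂μ) :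
    ∫ ω, F ω ∂μ = ∫ ω, G ω ∂μ := by
  rw [← setIntegral_univ, ← setIntegral_univ (f := G), ← iUnion_servingCell X D,
    integral_iUnion (hX.measurableSet_servingCell D) (pairwise_disjoint_servingCell X D)
      hF.integrableOn,
    integral_iUnion (hX.measurableSet_servingCell D) (pairwise_disjoint_servingCell X D)
      hG.integrableOn]
  simp_rw [h]

/-- On each serving cell the product is a function of finitely many counts, which are known to be
almost everywhere measurable because they have a law. -/
lemma IsPPP.aestronglyMeasurable_cellProd (hX : IsPPP μ lam X) (a : ℝ) {D : ℝ} (hD : 0 < D)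
    (M : ℕ) : AEStronglyMeasurable (fun ω => cellProd a D M (fun n => ‖X n ω‖ ^ 2)) μ := by
  rw [← Measure.restrict_univ (μ := μ), ← iUnion_servingCell X D, aestronglyMeasurable_iUnion_iff]
  intro i
  have hm : AEMeasurable (fun ω => ∏ x ∈ Finset.range (M * i - i),
      rayleighLT a (i / (i + 1 + x : ℕ)) ^ (count X (cell D (i + 1 + x)) ω).toNat) μ := by
    refine Finset.aemeasurable_fun_prod _ fun x _ => ?_
    exact (Measurable.of_discrete (f := fun N : ℕ∞ =>
      rayleighLT a (i / (i + 1 + x : ℕ)) ^ N.toNat)).comp_aemeasurable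
        (hX.count_law _ (measurableSet_cell D _) (isBounded_cell hD _)).aemeasurable
  refine hm.aestronglyMeasurable.restrict.congr ?_
  filter_upwards [ae_restrict_mem (hX.measurableSet_servingCell D i)] with ω hω
  exact (cellProd_of_mem_servingCell hω).symm

lemma IsPPP.measurable_fadingProd (hX : IsPPP μ lam X) (a : ℝ) (n : ℕ) :
    Measurable (fadingProd X a n) := by
  have := hX.measurable
  unfold fadingProd rayleighLT
  fun_prop

end

section

variable {Ω : Type*} [MeasurableSpace Ω] {μ : Measure Ω} [IsProbabilityMeasure μ] {lam : ℝ}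
  {X : ℕ → Ω → Plane}

lemma IsPPP.integrable_cellProd (hX : IsPPP μ lam X) {a : ℝ} (ha : 0 ≤ a) {D : ℝ} (hD : 0 < D)
    (M : ℕ) : Integrable (fun ω => cellProd a D M (fun n => ‖X n ω‖ ^ 2)) μ := by
  refine Integrable.of_bound (C := 1) (hX.aestronglyMeasurable_cellProd a hD M)
    (ae_of_all _ fun ω => ?_)
  rw [Real.norm_of_nonneg (cellProd_nonneg ha _ _ _)]
  exact cellProd_le_one ha _ _ _

lemma IsPPP.integrable_exp_neg_cellIdx (hX : IsPPP μ lam X) (D : ℝ) {g : ℕ → ℝ}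
    (hg : ∀ i, 0 ≤ g i) :
    Integrable (fun ω => Real.exp (-g (cellIdx D (‖X 0 ω‖ ^ 2)))) μ := by
  refine Integrable.of_bound (C := 1) ?_ (ae_of_all _ fun ω => ?_)
  · exact ((Measurable.of_discrete (f := fun i : ℕ => Real.exp (-g i))).comp
      (hX.measurable_cellIdx D 0)).aestronglyMeasurable
  · rw [Real.norm_of_nonneg (Real.exp_pos _).le, Real.exp_le_one_iff]
    linarith [hg (cellIdx D (‖X 0 ω‖ ^ 2))]

/-- On the serving cell `i` the mean of `cellProd` is exactly an exponential of a Riemann sum.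
Replacing the sum by its integral changes the exponent by at most λπD, and x ↦ e^{-x} is 1-Lipschitz
on x ≥ 0. -/
lemma IsPPP.abs_integral_cellProd_sub_le (hX : IsPPP μ lam X) (hlam : 0 ≤ lam)
    (ho : ∀ᵐ ω ∂μ, Monotone fun n => ‖X n ω‖) {a : ℝ} (ha : 0 < a) {D : ℝ} (hD : 0 < D) {M : ℕ}
    (hM : 1 ≤ M) :
    |∫ ω, cellProd a D M (fun n => ‖X n ω‖ ^ 2) ∂μ - ∫ ω, Real.exp (-(lam * (Real.pi * D) *
      (cellIdx D (‖X 0 ω‖ ^ 2) * windowExponent a M))) ∂μ| ≤ lam * (Real.pi * D) := by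
  have hm0 : 0 ≤ lam * (Real.pi * D) := by positivity
  set S : ℕ → ℝ := fun i =>
    ∑ x ∈ Finset.range (M * i - i), (1 - rayleighLT a (i / (i + 1 + x : ℕ))) with hS
  have hS0 : ∀ i, 0 ≤ lam * (Real.pi * D) * S i := fun i =>
    mul_nonneg hm0 (Finset.sum_nonneg fun x _ => sub_nonneg.2 (rayleighLT_le_one ha.le _))
  have hW0 : ∀ i : ℕ, 0 ≤ lam * (Real.pi * D) * (i * windowExponent a M) := fun i =>
    mul_nonneg hm0 (mul_nonneg (Nat.cast_nonneg i)
      (windowExponent_nonneg (by exact_mod_cast hM)))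
  have hI1 := hX.integrable_exp_neg_cellIdx D hS0
  have hI2 := hX.integrable_exp_neg_cellIdx D hW0
  have e : ∫ ω, cellProd a D M (fun n => ‖X n ω‖ ^ 2) ∂μ =
      ∫ ω, Real.exp (-(lam * (Real.pi * D) * S (cellIdx D (‖X 0 ω‖ ^ 2)))) ∂μ := by
    refine integral_eq_of_setIntegral_servingCell hX D (hX.integrable_cellProd ha.le hD M) hI1
      fun i => ?_
    have hmi := hX.measurableSet_servingCell D i
    rw [setIntegral_congr_fun hmi fun ω hω => cellProd_of_mem_servingCell hω,
      hX.setIntegral_servingCell hlam ho hD i _ fun x => rayleighLT a (i / (i + 1 + x : ℕ)),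
      setIntegral_congr_fun (g := fun _ => Real.exp (-(lam * (Real.pi * D) * S i))) hmi,
      setIntegral_const, smul_eq_mul]
    intro ω hω
    have : cellIdx D (‖X 0 ω‖ ^ 2) = i := hω
    simp only [this]
  rw [e, ← integral_sub hI1 hI2]
  refine (abs_integral_le_integral_abs).trans ?_
  refine (integral_mono_of_nonneg (ae_of_all _ fun _ => abs_nonneg _)
    (integrable_const (lam * (Real.pi * D))) (ae_of_all _ fun ω => ?_)).trans (by simp)
  refine (abs_exp_neg_sub_exp_neg_le (hS0 _) (hW0 _)).trans ?_
  rw [← mul_sub, abs_mul, abs_of_nonneg hm0]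
  exact mul_le_of_le_one_right hm0 (abs_sum_sub_windowExponent_le ha _ hM)

lemma IsPPP.tendsto_cellProd_fadingProd (hX : IsPPP μ lam X) (hlam : 0 ≤ lam)
    (ho : ∀ᵐ ω ∂μ, Monotone fun n => ‖X n ω‖) {a : ℝ} (ha : 0 ≤ a) (M : ℕ) :
    ∀ᵐ ω ∂μ, Tendsto (fun n : ℕ => cellProd a (1 / ((n : ℝ) + 1)) M (fun n => ‖X n ω‖ ^ 2)) atTop
      (nhds (fadingProd X a (windowLen M fun n => ‖X n ω‖ ^ 2) ω)) := by
  filter_upwards [ho, hX.ae_tendsto_norm ho, hX.ae_norm_pos hlam ho, hX.ae_norm_lt hlam ho]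
    with ω h1 h2 h3 h4
  have hm : Monotone fun n => ‖X n ω‖ ^ 2 := fun a b hab =>
    pow_le_pow_left₀ (norm_nonneg _) (h1 hab) 2
  refine tendsto_cellProd ha hm h2 (by positivity) h4 (fun n => by positivity) (fun n => ?_)
    tendsto_one_div_add_atTop_nhds_zero_nat
  rw [div_le_one (by positivity)]
  linarith [(Nat.cast_nonneg n : (0 : ℝ) ≤ n)]

lemma IsPPP.aestronglyMeasurable_fadingProd_windowLen (hX : IsPPP μ lam X) (hlam : 0 ≤ lam)
    (ho : ∀ᵐ ω ∂μ, Monotone fun n => ‖X n ω‖) {a : ℝ} (ha : 0 ≤ a) (M : ℕ) :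
    AEStronglyMeasurable
      (fun ω => fadingProd X a (windowLen M fun n => ‖X n ω‖ ^ 2) ω) μ :=
  aestronglyMeasurable_of_tendsto_ae atTop
    (fun n : ℕ => hX.aestronglyMeasurable_cellProd a (by positivity) M)
    (hX.tendsto_cellProd_fadingProd hlam ho ha M)

/-- As D → 0, `cellProd` tends to the product over the window and D times the serving index tends to
r_0², while the error λπD vanishes. What remains is the Laplace transform of r_0². -/
lemma IsPPP.integral_fadingProd_windowLen (hX : IsPPP μ lam X) (hlam : 0 < lam)
    (ho : ∀ᵐ ω ∂μ, Monotone fun n => ‖X n ω‖) {a : ℝ} (ha : 0 < a) {M : ℕ} (hM : 1 ≤ M) :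
    ∫ ω, fadingProd X a (windowLen M fun n => ‖X n ω‖ ^ 2) ω ∂μ =
      1 / (1 + windowExponent a M) := by
  set D : ℕ → ℝ := fun n => 1 / ((n : ℝ) + 1) with hDdef
  have hD : ∀ n, 0 < D n := fun n => by simp only [hDdef]; positivity
  have hD0 : Tendsto D atTop (nhds 0) := tendsto_one_div_add_atTop_nhds_zero_nat
  have hw : 0 ≤ windowExponent a M := windowExponent_nonneg (by exact_mod_cast hM)
  have h1 : Tendsto (fun n => ∫ ω, cellProd a (D n) M (fun n => ‖X n ω‖ ^ 2) ∂μ) atTop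
      (nhds (∫ ω, fadingProd X a (windowLen M fun n => ‖X n ω‖ ^ 2) ω ∂μ)) := by
    refine tendsto_integral_of_dominated_convergence (fun _ => 1)
      (fun n => hX.aestronglyMeasurable_cellProd a (hD n) M) (integrable_const _)
      (fun n => ae_of_all _ fun ω => ?_) (hX.tendsto_cellProd_fadingProd hlam.le ho ha.le M)
    rw [Real.norm_of_nonneg (cellProd_nonneg ha.le _ _ _)]
    exact cellProd_le_one ha.le _ _ _
  have h2 : Tendsto (fun n => ∫ ω, Real.exp (-(lam * (Real.pi * D n) *
      (cellIdx (D n) (‖X 0 ω‖ ^ 2) * windowExponent a M))) ∂μ) atTop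
      (nhds (1 / (1 + windowExponent a M))) := by
    rw [← hX.integral_exp_neg_norm_sq hlam ho hw]
    have hnn : ∀ n i : ℕ, 0 ≤ lam * (Real.pi * D n) * (i * windowExponent a M) := fun n i => by
      have := hD n
      positivity
    refine tendsto_integral_of_dominated_convergence (fun _ => 1)
      (fun n => (hX.integrable_exp_neg_cellIdx (D n) (hnn n)).aestronglyMeasurable)
      (integrable_const _) (fun n => ae_of_all _ fun ω => ?_) (ae_of_all _ fun ω => ?_)
    · rw [Real.norm_of_nonneg (Real.exp_pos _).le, Real.exp_le_one_iff]
      linarith [hnn n (cellIdx (D n) (‖X 0 ω‖ ^ 2))]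
    · have := tendsto_mul_cellIdx (sq_nonneg ‖X 0 ω‖) hD hD0
      refine (Real.continuous_exp.tendsto _).comp
        ((((this.const_mul (lam * Real.pi)).mul_const (windowExponent a M)).neg).congr
          fun n => ?_)
      ring
  have h3 : Tendsto (fun n => lam * (Real.pi * D n)) atTop (nhds 0) := by
    simpa using (hD0.const_mul Real.pi).const_mul lam
  have h4 := le_of_tendsto_of_tendsto' (h1.sub h2).abs h3 fun n =>
    hX.abs_integral_cellProd_sub_le hlam.le ho ha (hD n) hM
  exact sub_eq_zero.1 (abs_nonpos_iff.1 h4)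

/-- The mean of the product is computed for a random window, not for a fixed number of factors. Both
families converge pointwise to the infimum of the decreasing partial products, so by dominated
convergence their means have the same limit. -/
lemma IsPPP.tendsto_integral_fadingProd (hX : IsPPP μ lam X) (hlam : 0 < lam)
    (ho : ∀ᵐ ω ∂μ, Monotone fun n => ‖X n ω‖) {a : ℝ} (ha : 0 ≤ a) :
    Tendsto (fun n => ∫ ω, fadingProd X a n ω ∂μ) atTop
      (nhds (1 / (1 + √a * Real.arctan √a))) := by
  -- `windowExponent` divides by √a, so a = 0 is treated apart.
  rcases ha.eq_or_lt with rfl | ha'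
  · simp [fadingProd, rayleighLT]
  have hlim : ∀ ω, Tendsto (fun n => fadingProd X a n ω) atTop
      (nhds (⨅ n, fadingProd X a n ω)) := fun ω =>
    tendsto_atTop_ciInf (antitone_fadingProd ha ω)
      ⟨0, by rintro _ ⟨n, rfl⟩; exact fadingProd_nonneg ha n ω⟩
  have hb : ∀ n ω, ‖fadingProd X a n ω‖ ≤ 1 := fun n ω => by
    rw [Real.norm_of_nonneg (fadingProd_nonneg ha n ω)]
    exact fadingProd_le_one ha n ω
  have h1 := tendsto_integral_of_dominated_convergence (μ := μ) (fun _ => 1)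
    (fun n => (hX.measurable_fadingProd a n).aestronglyMeasurable) (integrable_const _)
    (fun n => ae_of_all _ (hb n)) (ae_of_all _ hlim)
  have h2 := tendsto_integral_of_dominated_convergence (μ := μ)
    (F := fun (M : ℕ) ω => fadingProd X a (windowLen M fun n => ‖X n ω‖ ^ 2) ω)
    (f := fun ω => ⨅ n, fadingProd X a n ω) (fun _ => 1)
    (fun M => hX.aestronglyMeasurable_fadingProd_windowLen hlam.le ho ha M) (integrable_const _)
    (fun M => ae_of_all _ fun ω => hb _ ω) (by
      filter_upwards [ho, hX.ae_tendsto_norm ho, hX.ae_norm_pos hlam.le ho] with ω g1 g2 g3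
      have hm : Monotone fun n => ‖X n ω‖ ^ 2 := fun a b hab =>
        pow_le_pow_left₀ (norm_nonneg _) (g1 hab) 2
      exact (hlim ω).comp (tendsto_windowLen hm g2 (by positivity)))
  have h3 : Tendsto (fun M : ℕ => 1 / (1 + windowExponent a M)) atTop
      (nhds (1 / (1 + √a * Real.arctan √a))) := by
    refine tendsto_const_nhds.div (tendsto_const_nhds.add (tendsto_windowExponent ha')) ?_
    have := Real.arctan_nonneg.2 (Real.sqrt_nonneg a)
    positivity
  have h4 := h3.congr' (f₂ := fun M : ℕ =>
    ∫ ω, fadingProd X a (windowLen M fun n => ‖X n ω‖ ^ 2) ω ∂μ) (by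
      filter_upwards [eventually_ge_atTop 1] with M hM
      exact (hX.integral_fadingProd_windowLen hlam ho ha' hM).symm)
  rwa [tendsto_nhds_unique h2 h4] at h1

end

/-! ### The normalised interference -/

/-- Power received from the `k`-th interferer, relative to the path loss of the serving link. -/
noncomputable def relPower {Ω : Type*} (X : ℕ → Ω → Plane) (h : ℕ → Ω → ℂ) (k : ℕ) (ω : Ω) : ℝ :=
  (‖X 0 ω‖ ^ 2 / ‖X (k + 1) ω‖ ^ 2) ^ 2 * ‖h (k + 1) ω‖ ^ 2

lemma relPower_nonneg {Ω : Type*} (X : ℕ → Ω → Plane) (h : ℕ → Ω → ℂ) (k : ℕ) (ω : Ω) :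
    0 ≤ relPower X h k ω := by
  unfold relPower; positivity

lemma rpow_neg_four (x : ℝ) : x ^ (-4 : ℝ) = (x ^ 4)⁻¹ := by
  rw [show (-4 : ℝ) = ((-4 : ℤ) : ℝ) by norm_num, Real.rpow_intCast]
  rfl

lemma relPower_eq {Ω : Type*} {P : ℝ} (hP : P ≠ 0) (X : ℕ → Ω → Plane) (h : ℕ → Ω → ℂ) (k : ℕ)
    (ω : Ω) : relPower X h k ω = ‖X 0 ω‖ ^ 4 / P * rxPower P 4 X h (k + 1) ω := by
  unfold relPower rxPower
  rw [rpow_neg_four, div_pow]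
  field_simp

section

variable {Ω : Type*} {P : ℝ} {X : ℕ → Ω → Plane} {h : ℕ → Ω → ℂ}

lemma tsum_relPower (hP : P ≠ 0) (ω : Ω) :
    ∑' k, relPower X h k ω = serviceDist X ω ^ 4 / P * interference P 4 X h ω := by
  simp_rw [relPower_eq hP, tsum_mul_left]
  rfl

lemma sinr_nonneg (hP : 0 < P) (ω : Ω) : 0 ≤ sinr P 4 0 X h ω := by
  have : ∀ k, 0 ≤ rxPower P 4 X h k ω := fun k => by unfold rxPower; positivity
  unfold sinr interference
  have h1 := this 0
  have h2 : 0 ≤ ∑' k, rxPower P 4 X h (k + 1) ω := tsum_nonneg fun k => this _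
  positivity

end

section

variable {Ω : Type*} [MeasurableSpace Ω] {μ : Measure Ω} {lam : ℝ} {X : ℕ → Ω → Plane}
  {h : ℕ → Ω → ℂ}

lemma IsDownlinkNetwork.measurable_relPower (hnet : IsDownlinkNetwork μ lam X h) (k : ℕ) :
    Measurable (relPower X h k) := by
  have := hnet.ppp.measurable
  have := hnet.fading_measurable
  unfold relPower
  fun_prop

/-- The law has a radial density, so it does not charge the origin. This makes the interference
positive, hence the ratio genuine. -/
lemma IsDownlinkNetwork.ae_norm_fading_pos (hnet : IsDownlinkNetwork μ lam X h) (k : ℕ) :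
    ∀ᵐ ω ∂μ, 0 < ‖h k ω‖ := by
  rw [(hnet.fading_law k).ae_iff (p := fun z => 0 < ‖z‖) (measurableSet_setOfPred.1
    (measurableSet_lt measurable_const (by fun_prop)))]
  have hs : MeasurableSet ({0} : Set ℂ) := measurableSet_singleton 0
  have h1 := integral_indicator_one (μ := complexGaussian) hs
  have h2 := integral_norm_complexGaussian (indicator {(0 : ℝ)} 1)
  have h3 : ∀ z : ℂ, indicator ({0} : Set ℂ) (1 : ℂ → ℝ) z =
      indicator {(0 : ℝ)} (1 : ℝ → ℝ) ‖z‖ := fun z => by simp [indicator]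
  simp_rw [h3] at h1
  rw [h2, setIntegral_congr_fun (g := fun _ => 0) measurableSet_Ioi fun r (hr : 0 < r) => by
    simp [hr.ne'], integral_zero, eq_comm, measureReal_eq_zero_iff] at h1
  rw [ae_iff]
  simpa using h1

end

/-! ### Averaging over fading: convergence, Laplace transform and coverage -/

section

variable {Ω : Type*} [MeasurableSpace Ω] {μ : Measure Ω} [IsProbabilityMeasure μ] {lam P : ℝ}
  {X : ℕ → Ω → Plane} {h : ℕ → Ω → ℂ}

/-- Fubini for the product law: the locations are frozen while the fading is averaged. -/
lemma integral_comp_of_indepFun (hXm : ∀ n, Measurable (X n)) (hm : ∀ n, Measurable (h n))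
    (hind : IndepFun (fun ω n => X n ω) (fun ω n => h n ω) μ)
    {F : (ℕ → Plane) → (ℕ → ℂ) → ℝ} (hF : Measurable (Function.uncurry F))
    (hF1 : ∀ x y, ‖F x y‖ ≤ 1) :
    ∫ ω, F (fun n => X n ω) (fun n => h n ω) ∂μ =
      ∫ ω, ∫ ω', F (fun n => X n ω) (fun n => h n ω') ∂μ ∂μ := by
  have hX' : Measurable fun ω n => X n ω := measurable_pi_lambda _ hXm
  have hh' : Measurable fun ω n => h n ω := measurable_pi_lambda _ hm
  have : IsProbabilityMeasure (μ.map fun ω n => X n ω) :=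
    Measure.isProbabilityMeasure_map hX'.aemeasurable
  have : IsProbabilityMeasure (μ.map fun ω n => h n ω) :=
    Measure.isProbabilityMeasure_map hh'.aemeasurable
  have hprod := (indepFun_iff_map_prod_eq_prod_map_map hX'.aemeasurable hh'.aemeasurable).1 hind
  have h1 := integral_map (μ := μ) (hX'.prodMk hh').aemeasurable
    (f := Function.uncurry F) hF.aestronglyMeasurable
  rw [hprod, integral_prod _ (Integrable.of_bound (C := 1) hF.aestronglyMeasurable
    (ae_of_all _ fun p => hF1 p.1 p.2)), integral_map hX'.aemeasurable] at h1
  · refine h1.symm.trans (integral_congr_ae (ae_of_all _ fun ω => ?_))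
    exact integral_map hh'.aemeasurable (hF.comp measurable_prodMk_left).aestronglyMeasurable
  · exact (hF.stronglyMeasurable.integral_prod_right
      (ν := μ.map fun ω n => h n ω)).aestronglyMeasurable

lemma IsDownlinkNetwork.integral_exp_neg_sum_relPower (hnet : IsDownlinkNetwork μ lam X h)
    {a : ℝ} (ha : 0 ≤ a) (n : ℕ) :
    ∫ ω, Real.exp (-(a * ∑ k ∈ Finset.range n, relPower X h k ω)) ∂μ =
      ∫ ω, fadingProd X a n ω ∂μ := by
  have hF := integral_comp_of_indepFun hnet.ppp.measurable hnet.fading_measurable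
    hnet.fading_indep_ppp (F := fun x y => Real.exp (-∑ k ∈ Finset.range n,
      a * (‖x 0‖ ^ 2 / ‖x (k + 1)‖ ^ 2) ^ 2 * ‖y (k + 1)‖ ^ 2))
    (by unfold Function.uncurry; fun_prop) (fun x y => by
      rw [Real.norm_of_nonneg (Real.exp_pos _).le, Real.exp_le_one_iff, neg_nonpos]
      exact Finset.sum_nonneg fun k _ => by positivity)
  simp only at hF
  have e : ∀ ω, a * ∑ k ∈ Finset.range n, relPower X h k ω = ∑ k ∈ Finset.range n,
      a * (‖X 0 ω‖ ^ 2 / ‖X (k + 1) ω‖ ^ 2) ^ 2 * ‖h (k + 1) ω‖ ^ 2 := by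
    intro ω
    simp only [Finset.mul_sum, relPower, mul_assoc]
  simp_rw [e, hF]
  refine integral_congr_ae (ae_of_all _ fun ω => ?_)
  exact integral_exp_neg_sum_fading hnet.fading_measurable hnet.fading_law hnet.fading_indep n
    (fun k => a * (‖X 0 ω‖ ^ 2 / ‖X (k + 1) ω‖ ^ 2) ^ 2) (fun k => by positivity)

lemma IsDownlinkNetwork.measureReal_sum_relPower_le (hnet : IsDownlinkNetwork μ lam X h)
    {a : ℝ} (ha : 0 ≤ a) (n : ℕ) :
    μ.real {ω | a * ∑ k ∈ Finset.range n, relPower X h k ω ≤ ‖h 0 ω‖ ^ 2} =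
      ∫ ω, fadingProd X a n ω ∂μ := by
  have e : ∀ ω, a * ∑ k ∈ Finset.range n, relPower X h k ω = ∑ k ∈ Finset.range n,
      a * (‖X 0 ω‖ ^ 2 / ‖X (k + 1) ω‖ ^ 2) ^ 2 * ‖h (k + 1) ω‖ ^ 2 := by
    intro ω
    simp only [Finset.mul_sum, relPower, mul_assoc]
  simp_rw [e]
  have hXm := hnet.ppp.measurable
  have hhm := hnet.fading_measurable
  have hS : MeasurableSet {p : (ℕ → Plane) × (ℕ → ℂ) | ∑ k ∈ Finset.range n,
      a * (‖p.1 0‖ ^ 2 / ‖p.1 (k + 1)‖ ^ 2) ^ 2 * ‖p.2 (k + 1)‖ ^ 2 ≤ ‖p.2 0‖ ^ 2} :=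
    measurableSet_le (by fun_prop) (by fun_prop)
  have hF := integral_comp_of_indepFun hXm hhm
    hnet.fading_indep_ppp (F := fun x y => indicator {p : (ℕ → Plane) × (ℕ → ℂ) |
      ∑ k ∈ Finset.range n, a * (‖p.1 0‖ ^ 2 / ‖p.1 (k + 1)‖ ^ 2) ^ 2 * ‖p.2 (k + 1)‖ ^ 2 ≤
        ‖p.2 0‖ ^ 2} 1 (x, y))
    (measurable_one.indicator hS) (fun x y => by
      unfold indicator
      split_ifs <;> simp)
  have hSω : MeasurableSet {ω | ∑ k ∈ Finset.range n,
      a * (‖X 0 ω‖ ^ 2 / ‖X (k + 1) ω‖ ^ 2) ^ 2 * ‖h (k + 1) ω‖ ^ 2 ≤ ‖h 0 ω‖ ^ 2} :=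
    measurableSet_le (by fun_prop) (by fun_prop)
  rw [← integral_indicator_one hSω]
  refine (Eq.trans ?_ hF).trans ?_
  · rfl
  refine integral_congr_ae (ae_of_all _ fun ω => ?_)
  have hSω' : MeasurableSet {ω' | ∑ k ∈ Finset.range n,
      a * (‖X 0 ω‖ ^ 2 / ‖X (k + 1) ω‖ ^ 2) ^ 2 * ‖h (k + 1) ω'‖ ^ 2 ≤ ‖h 0 ω'‖ ^ 2} :=
    measurableSet_le (by fun_prop) (by fun_prop)
  have := measureReal_sum_fading_le hhm hnet.fading_law hnet.fading_indep n
    (fun k => a * (‖X 0 ω‖ ^ 2 / ‖X (k + 1) ω‖ ^ 2) ^ 2) (fun k => by positivity)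
  rw [← integral_indicator_one hSω'] at this
  exact this

-- The value 0 off the summable set is the limit of exp(-a · partial sums) when these diverge and a
-- > 0. The limit therefore exists everywhere, without knowing beforehand that the series converges.
open Classical in
lemma IsDownlinkNetwork.integral_exp_neg_tsum_relPower_ite (hnet : IsDownlinkNetwork μ lam X h)
    (hlam : 0 < lam) {a : ℝ} (ha : 0 < a) :
    AEStronglyMeasurable (fun ω => if Summable fun k => relPower X h k ω then
        Real.exp (-(a * ∑' k, relPower X h k ω)) else 0) μ ∧
    ∫ ω, (if Summable fun k => relPower X h k ω then
        Real.exp (-(a * ∑' k, relPower X h k ω)) else 0) ∂μ =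
      1 / (1 + √a * Real.arctan √a) := by
  have hlim : ∀ ω, Tendsto
      (fun n => Real.exp (-(a * ∑ k ∈ Finset.range n, relPower X h k ω))) atTop
      (nhds (if Summable fun k => relPower X h k ω then
        Real.exp (-(a * ∑' k, relPower X h k ω)) else 0)) := by
    intro ω
    split_ifs with hs
    · exact (Real.continuous_exp.tendsto _).comp
        ((hs.hasSum.tendsto_sum_nat.const_mul a).neg)
    · have := (not_summable_iff_tendsto_nat_atTop_of_nonneg
        fun k => relPower_nonneg X h k ω).1 hs
      exact Real.tendsto_exp_neg_atTop_nhds_zero.comp (this.const_mul_atTop ha)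
  have hm : ∀ n, AEStronglyMeasurable
      (fun ω => Real.exp (-(a * ∑ k ∈ Finset.range n, relPower X h k ω))) μ := fun n => by
    have := hnet.measurable_relPower
    exact Measurable.aestronglyMeasurable (by fun_prop)
  refine ⟨aestronglyMeasurable_of_tendsto_ae atTop hm (ae_of_all _ hlim), ?_⟩
  have h1 := tendsto_integral_of_dominated_convergence (μ := μ) (fun _ => 1) hm
    (integrable_const _) (fun n => ae_of_all _ fun ω => by
      rw [Real.norm_of_nonneg (Real.exp_pos _).le, Real.exp_le_one_iff, neg_nonpos]
      exact mul_nonneg ha.le (Finset.sum_nonneg fun k _ => relPower_nonneg X h k ω))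
    (ae_of_all _ hlim)
  simp_rw [hnet.integral_exp_neg_sum_relPower ha.le] at h1
  exact tendsto_nhds_unique h1 (hnet.ppp.tendsto_integral_fadingProd hlam hnet.ordered ha.le)

/-- As a → 0 the truncated transform tends to the indicator of summability, while its closed form
tends to 1. So that indicator has mean 1. -/
lemma IsDownlinkNetwork.ae_summable_relPower (hnet : IsDownlinkNetwork μ lam X h)
    (hlam : 0 < lam) : ∀ᵐ ω ∂μ, Summable fun k => relPower X h k ω := by
  classical
  set a : ℕ → ℝ := fun n => 1 / ((n : ℝ) + 1) with hadef
  have ha : ∀ n, 0 < a n := fun n => by simp only [hadef]; positivity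
  have ha0 : Tendsto a atTop (nhds 0) := tendsto_one_div_add_atTop_nhds_zero_nat
  set W : Ω → ℝ := fun ω => if Summable fun k => relPower X h k ω then 1 else 0 with hW
  have hlim : ∀ ω, Tendsto (fun n => if Summable fun k => relPower X h k ω then
        Real.exp (-(a n * ∑' k, relPower X h k ω)) else 0) atTop (nhds (W ω)) := by
    intro ω
    simp only [hW]
    split_ifs with hs
    · have := ((Real.continuous_exp.tendsto _).comp
        ((ha0.mul_const (∑' k, relPower X h k ω)).neg))
      simpa [Function.comp_def] using this
    · exact tendsto_const_nhds
  have hm := fun n => (hnet.integral_exp_neg_tsum_relPower_ite hlam (ha n)).1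
  have hWm : AEStronglyMeasurable W μ :=
    aestronglyMeasurable_of_tendsto_ae atTop hm (ae_of_all _ hlim)
  have h1 := tendsto_integral_of_dominated_convergence (μ := μ) (fun _ => 1) hm
    (integrable_const _) (fun n => ae_of_all _ fun ω => by
      split_ifs with hs
      · rw [Real.norm_of_nonneg (Real.exp_pos _).le, Real.exp_le_one_iff, neg_nonpos]
        exact mul_nonneg (ha n).le (tsum_nonneg fun k => relPower_nonneg X h k ω)
      · simp) (ae_of_all _ hlim)
  have h2 : Tendsto (fun n => 1 / (1 + √(a n) * Real.arctan √(a n))) atTop (nhds 1) := by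
    have hc : Tendsto (fun x : ℝ => 1 / (1 + √x * Real.arctan √x)) (nhds 0)
        (nhds (1 / (1 + √0 * Real.arctan √0))) :=
      tendsto_const_nhds.div ((by fun_prop : Continuous fun x : ℝ =>
        1 + √x * Real.arctan √x).tendsto 0) (by simp)
    simpa [Function.comp_def] using hc.comp ha0
  simp_rw [fun n => (hnet.integral_exp_neg_tsum_relPower_ite hlam (ha n)).2] at h1
  have hWint : ∫ ω, W ω ∂μ = 1 := tendsto_nhds_unique h1 h2
  have hWi : Integrable W μ := Integrable.of_bound (C := 1) hWm (ae_of_all _ fun ω => by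
    simp only [hW]; split_ifs <;> simp)
  have h3 : ∫ ω, (1 - W ω) ∂μ = 0 := by
    rw [integral_sub (integrable_const _) hWi, hWint]
    simp
  have h4 := (integral_eq_zero_iff_of_nonneg_ae (ae_of_all _ fun ω => by
    simp only [hW, Pi.zero_apply, Pi.sub_apply]; split_ifs <;> simp) ((integrable_const 1).sub hWi)).1 h3
  filter_upwards [h4] with ω hω
  by_contra hs
  simp [hW, hs] at hω

lemma IsDownlinkNetwork.ae_norm_pos (hnet : IsDownlinkNetwork μ lam X h) (hlam : 0 < lam) :
    ∀ᵐ ω ∂μ, ∀ k, 0 < ‖X k ω‖ := by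
  filter_upwards [hnet.ppp.ae_norm_pos hlam.le hnet.ordered, hnet.ordered] with ω h1 h2 k
  exact h1.trans_le (h2 (Nat.zero_le k))

lemma IsDownlinkNetwork.ae_summable_rxPower (hnet : IsDownlinkNetwork μ lam X h) (hlam : 0 < lam)
    (hP : 0 < P) : ∀ᵐ ω ∂μ, Summable fun k => rxPower P 4 X h (k + 1) ω := by
  filter_upwards [hnet.ae_summable_relPower hlam, hnet.ae_norm_pos hlam] with ω h1 h2
  simp_rw [relPower_eq hP.ne'] at h1
  have := h2 0
  exact (summable_mul_left_iff (by positivity)).1 h1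

lemma IsDownlinkNetwork.integral_exp_neg_interference (hnet : IsDownlinkNetwork μ lam X h)
    (hlam : 0 < lam) (hP : 0 < P) {a : ℝ} (ha : 0 ≤ a) :
    ∫ ω, Real.exp (-(a * serviceDist X ω ^ 4 / P * interference P 4 X h ω)) ∂μ =
      1 / (1 + √a * Real.arctan √a) := by
  classical
  rcases ha.eq_or_lt with rfl | ha
  · simp
  rw [← (hnet.integral_exp_neg_tsum_relPower_ite hlam ha).2]
  refine integral_congr_ae ?_
  filter_upwards [hnet.ae_summable_relPower hlam] with ω hω
  rw [if_pos hω, tsum_relPower hP.ne']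
  ring_nf

lemma IsDownlinkNetwork.ae_interference_pos (hnet : IsDownlinkNetwork μ lam X h) (hlam : 0 < lam)
    (hP : 0 < P) : ∀ᵐ ω ∂μ, 0 < interference P 4 X h ω := by
  filter_upwards [hnet.ae_summable_rxPower hlam hP, hnet.ae_norm_pos hlam,
    hnet.ae_norm_fading_pos 1] with ω h1 h2 h3
  refine h1.tsum_pos (fun k => by unfold rxPower; positivity) 0 ?_
  have := h2 1
  have := Real.rpow_pos_of_pos this (-4)
  unfold rxPower
  simp only [zero_add]
  positivity

lemma IsDownlinkNetwork.aemeasurable_interference (hnet : IsDownlinkNetwork μ lam X h)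
    (hlam : 0 < lam) (hP : 0 < P) : AEMeasurable (interference P 4 X h) μ := by
  have hXm := hnet.ppp.measurable
  have hhm := hnet.fading_measurable
  refine (aestronglyMeasurable_of_tendsto_ae atTop (f := fun (n : ℕ) ω =>
    ∑ k ∈ Finset.range n, rxPower P 4 X h (k + 1) ω) (fun n => ?_) ?_).aemeasurable
  · refine Measurable.aestronglyMeasurable ?_
    unfold rxPower
    fun_prop
  · filter_upwards [hnet.ae_summable_rxPower hlam hP] with ω hω
    exact hω.hasSum.tendsto_sum_nat

lemma IsDownlinkNetwork.aemeasurable_sinr (hnet : IsDownlinkNetwork μ lam X h)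
    (hlam : 0 < lam) (hP : 0 < P) : AEMeasurable (sinr P 4 0 X h) μ := by
  have hXm := hnet.ppp.measurable
  have hhm := hnet.fading_measurable
  have h1 := hnet.aemeasurable_interference hlam hP
  have h2 : Measurable (rxPower P 4 X h 0) := by unfold rxPower; fun_prop
  exact h2.aemeasurable.div (h1.add_const 0)

/-- The events for partial sums decrease to the event for the full sum, and their probabilities are
the means of `fadingProd` already found. -/
lemma IsDownlinkNetwork.measureReal_tsum_relPower_le (hnet : IsDownlinkNetwork μ lam X h)
    (hlam : 0 < lam) {T : ℝ} (hT : 0 ≤ T) :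
    μ.real {ω | T * ∑' k, relPower X h k ω ≤ ‖h 0 ω‖ ^ 2} = 1 / (1 + √T * Real.arctan √T) := by
  have hm := hnet.measurable_relPower
  have hhm := hnet.fading_measurable
  set S : ℕ → Set Ω := fun n => {ω | T * ∑ k ∈ Finset.range n, relPower X h k ω ≤ ‖h 0 ω‖ ^ 2}
  have hSm : ∀ n, MeasurableSet (S n) := fun n => measurableSet_le (by fun_prop) (by fun_prop)
  have hanti : Antitone S := by
    intro m n hmn ω hω
    refine le_trans (mul_le_mul_of_nonneg_left ?_ hT) hω
    exact Finset.sum_le_sum_of_subset_of_nonneg (Finset.range_mono hmn)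
      fun k _ _ => relPower_nonneg X h k ω
  have h1 := tendsto_measure_iInter_atTop (μ := μ) (fun n => (hSm n).nullMeasurableSet) hanti
    ⟨0, measure_ne_top _ _⟩
  have h2 := (ENNReal.tendsto_toReal (measure_ne_top μ (⋂ n, S n))).comp h1
  have h3 : Tendsto (fun n => μ.real (S n)) atTop (nhds (1 / (1 + √T * Real.arctan √T))) := by
    simp_rw [S, hnet.measureReal_sum_relPower_le hT]
    exact hnet.ppp.tendsto_integral_fadingProd hlam hnet.ordered hT
  rw [← tendsto_nhds_unique h2 h3, ← Measure.real]
  refine measureReal_congr ?_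
  filter_upwards [hnet.ae_summable_relPower hlam] with ω hω
  refine propext ?_
  change T * ∑' k, relPower X h k ω ≤ ‖h 0 ω‖ ^ 2 ↔ ω ∈ ⋂ n, S n
  rw [mem_iInter]
  constructor
  · intro hle n
    refine le_trans (mul_le_mul_of_nonneg_left ?_ hT) hle
    exact hω.sum_le_tsum _ fun k _ => relPower_nonneg X h k ω
  · intro hle
    exact le_of_tendsto' (hω.hasSum.tendsto_sum_nat.const_mul T) hle

lemma IsDownlinkNetwork.measureReal_le_sinr (hnet : IsDownlinkNetwork μ lam X h)
    (hlam : 0 < lam) (hP : 0 < P) {T : ℝ} (hT : 0 ≤ T) :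
    μ.real {ω | T ≤ sinr P 4 0 X h ω} = 1 / (1 + √T * Real.arctan √T) := by
  rw [← hnet.measureReal_tsum_relPower_le hlam hT]
  refine measureReal_congr ?_
  filter_upwards [hnet.ae_interference_pos hlam hP, hnet.ae_norm_pos hlam] with ω h1 h2
  refine propext ?_
  change T ≤ sinr P 4 0 X h ω ↔ T * ∑' k, relPower X h k ω ≤ ‖h 0 ω‖ ^ 2
  have h0 := h2 0
  rw [tsum_relPower hP.ne', sinr, add_zero, le_div_iff₀ h1, rxPower, rpow_neg_four, serviceDist]
  rw [← div_eq_mul_inv, le_div_iff₀ (by positivity),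
    show T * (‖X 0 ω‖ ^ 4 / P * interference P 4 X h ω) =
      T * interference P 4 X h ω * ‖X 0 ω‖ ^ 4 / P by ring, div_le_iff₀ hP, mul_comm P]

lemma IsDownlinkNetwork.outage_eq (hnet : IsDownlinkNetwork μ lam X h)
    (hlam : 0 < lam) (hP : 0 < P) {T : ℝ} (hT : 0 ≤ T) :
    outage μ (sinr P 4 0 X h) T = 1 - 1 / (1 + √T * Real.arctan √T) := by
  rw [← hnet.measureReal_le_sinr hlam hP hT, outage]
  have hm : NullMeasurableSet {ω | T ≤ sinr P 4 0 X h ω} μ :=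
    nullMeasurableSet_le aemeasurable_const (hnet.aemeasurable_sinr hlam hP)
  rw [← probReal_compl_eq_one_sub₀ hm]
  congr 1
  ext ω
  simp

/-- Averaging a conditional Laplace transform over the service distance. -/
lemma IsDownlinkNetwork.integral_condLT (hnet : IsDownlinkNetwork μ lam X h)
    (hlam : 0 < lam) (hP : 0 < P) {a : ℝ} (ha : 0 ≤ a) :
    ∫ r in Ioi (0 : ℝ), 2 * Real.pi * lam * r * Real.exp (-(Real.pi * lam * r ^ 2)) *
        condLT μ P 4 X h (a * r ^ 4 / P) r =
      ∫ ω, Real.exp (-(a * serviceDist X ω ^ 4 / P * interference P 4 X h ω)) ∂μ := by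
  have hXm := hnet.ppp.measurable 0
  have hsm : Measurable (serviceDist X) := by unfold serviceDist; fun_prop
  have hIm := hnet.aemeasurable_interference hlam hP
  have hpm : IsProbabilityMeasure (μ.map (serviceDist X)) :=
    Measure.isProbabilityMeasure_map hsm.aemeasurable
  rw [← hnet.ppp.integral_serviceDist hlam hnet.ordered
    (fun r => condLT μ P 4 X h (a * r ^ 4 / P) r)]
  have hF : Measurable fun p : ℝ × ℝ => Real.exp (-(a * p.1 ^ 4 / P * p.2)) := by fun_prop
  have hmap := compProd_map_condDistrib (mβ := Real.measurableSpace)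
    (X := serviceDist X) (μ := μ) hIm
  -- The exponential is unbounded on the whole plane; it is at most 1 only because the interference
  -- is nonnegative, so the bound is transported from `μ` to the joint law.
  have hnn : ∀ᵐ p ∂(μ.map (serviceDist X) ⊗ₘ condDistrib (interference P 4 X h) (serviceDist X) μ),
      ‖Real.exp (-(a * p.1 ^ 4 / P * p.2))‖ ≤ 1 := by
    rw [hmap, ae_map_iff (hsm.aemeasurable.prodMk hIm) (measurableSet_le (by fun_prop) (by fun_prop))]
    refine ae_of_all _ fun ω => ?_
    rw [Real.norm_of_nonneg (Real.exp_pos _).le, Real.exp_le_one_iff, neg_nonpos]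
    have : 0 ≤ interference P 4 X h ω := tsum_nonneg fun k => by unfold rxPower; positivity
    simp only
    positivity
  have h1 := Measure.integral_compProd (Integrable.of_bound (C := 1) hF.aestronglyMeasurable hnn)
  rw [hmap, integral_map (hsm.aemeasurable.prodMk hIm) hF.aestronglyMeasurable] at h1
  exact h1.symm

end

/-! ### The complementary error function -/

lemma integrable_exp_neg_sq : Integrable fun t : ℝ => Real.exp (-t ^ 2) := by
  simpa using integrable_exp_neg_mul_sq one_pos

lemma erfc_zero : erfc 0 = 1 := by
  have h := integral_gaussian_Ioi 1
  simp only [neg_mul, one_mul, div_one] at h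
  have : √Real.pi ≠ 0 := (Real.sqrt_pos.2 Real.pi_pos).ne'
  rw [erfc, h]
  field_simp

lemma erfc_nonneg (x : ℝ) : 0 ≤ erfc x :=
  mul_nonneg (by positivity) (integral_nonneg fun _ => (Real.exp_pos _).le)

lemma erfc_eq (x : ℝ) : erfc x = 1 - 2 / √Real.pi * ∫ t in (0 : ℝ)..x, Real.exp (-t ^ 2) := by
  rw [← erfc_zero, erfc, erfc, ← intervalIntegral.integral_Ioi_sub_Ioi'
    integrable_exp_neg_sq.integrableOn integrable_exp_neg_sq.integrableOn]
  ring

lemma hasDerivAt_erfc (x : ℝ) : HasDerivAt erfc (-(2 / √Real.pi * Real.exp (-x ^ 2))) x := by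
  have hc : Continuous fun t : ℝ => Real.exp (-t ^ 2) := by fun_prop
  have h := ((hc.integral_hasStrictDerivAt 0 x).hasDerivAt.const_mul (2 / √Real.pi)).const_sub 1
  rwa [← funext erfc_eq] at h

lemma continuous_erfc : Continuous erfc :=
  continuous_iff_continuousAt.2 fun x => (hasDerivAt_erfc x).continuousAt

lemma erfc_le_one {x : ℝ} (hx : 0 ≤ x) : erfc x ≤ 1 := by
  rw [erfc_eq]
  have : 0 ≤ ∫ t in (0 : ℝ)..x, Real.exp (-t ^ 2) :=
    intervalIntegral.integral_nonneg hx fun _ _ => (Real.exp_pos _).le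
  have : 0 ≤ 2 / √Real.pi * ∫ t in (0 : ℝ)..x, Real.exp (-t ^ 2) := by positivity
  linarith

lemma hasDerivAt_erfc_sqrt {x : ℝ} (hx : 0 < x) :
    HasDerivAt (fun x => erfc √x) (-(1 / √Real.pi * (Real.exp (-x) / √x))) x := by
  have h := (hasDerivAt_erfc √x).comp x (Real.hasDerivAt_sqrt hx.ne')
  refine h.congr_deriv ?_
  rw [Real.sq_sqrt hx.le]
  have := (Real.sqrt_pos.2 hx).ne'
  field_simp

lemma integrableOn_exp_neg_div_sqrt :
    IntegrableOn (fun z => Real.exp (-z) / √z) (Ioi (0 : ℝ)) := by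
  refine (Real.GammaIntegral_convergent (s := 1 / 2) (by norm_num)).congr_fun (fun z hz => ?_)
    measurableSet_Ioi
  have hz : 0 < z := hz
  simp only
  rw [show (1 / 2 - 1 : ℝ) = -(1 / 2) by norm_num, Real.rpow_neg hz.le, ← Real.sqrt_eq_rpow,
    ← div_eq_mul_inv]

lemma integrableOn_exp_neg_mul_erfc_div_sqrt :
    IntegrableOn (fun z => Real.exp (-z) * erfc √z / √z) (Ioi (0 : ℝ)) := by
  have h := integrableOn_exp_neg_div_sqrt.bdd_mul (c := 1) (f := fun z => erfc √z)
    (continuous_erfc.comp Real.continuous_sqrt).aestronglyMeasurable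
    (ae_of_all _ fun z => by
      rw [Real.norm_of_nonneg (erfc_nonneg _)]
      exact erfc_le_one (Real.sqrt_nonneg z))
  refine h.congr (ae_of_all _ fun z => ?_)
  simp only
  ring

/-- Integration of the derivative from 0, where the singularity z^{-1/2} is integrable and erfc is
1. -/
lemma erfc_sqrt_eq {x : ℝ} (hx : 0 ≤ x) :
    erfc √x = 1 - ∫ z in Ioc 0 x, 1 / √Real.pi * (Real.exp (-z) / √z) := by
  have h := intervalIntegral.integral_eq_sub_of_hasDerivAt_of_le hx
    (f := fun x => erfc √x) (continuous_erfc.comp Real.continuous_sqrt).continuousOn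
    (fun z hz => hasDerivAt_erfc_sqrt hz.1)
    ((intervalIntegrable_iff_integrableOn_Ioc_of_le hx).2
      ((integrableOn_exp_neg_div_sqrt.mono_set Ioc_subset_Ioi_self).const_mul _).neg)
  rw [intervalIntegral.integral_of_le hx, integral_neg, Real.sqrt_zero, erfc_zero] at h
  linarith

/-- As for `erfc √x`; the chain rule supplies the factor 2 and the extra `erfc √z`. -/
lemma erfc_sqrt_sq_eq {x : ℝ} (hx : 0 ≤ x) :
    erfc √x ^ 2 = 1 - ∫ z in Ioc 0 x, 2 / √Real.pi * (Real.exp (-z) * erfc √z / √z) := by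
  have h := intervalIntegral.integral_eq_sub_of_hasDerivAt_of_le hx
    (f := fun x => erfc √x ^ 2) (f' := fun z => -(2 / √Real.pi * (Real.exp (-z) * erfc √z / √z)))
    ((continuous_erfc.comp Real.continuous_sqrt).pow 2).continuousOn
    (fun z hz => ((hasDerivAt_erfc_sqrt hz.1).pow 2).congr_deriv (by
      simp only [Nat.cast_ofNat, Nat.add_one_sub_one, pow_one]; ring))
    ((intervalIntegrable_iff_integrableOn_Ioc_of_le hx).2
      ((integrableOn_exp_neg_mul_erfc_div_sqrt.mono_set Ioc_subset_Ioi_self).const_mul _).neg)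
  rw [intervalIntegral.integral_of_le hx, integral_neg, Real.sqrt_zero, erfc_zero] at h
  linarith

/-! ### Tail formula for expectations -/

/-- A layer-cake formula: G(βY) is 1 minus the integral of k(z) over 0 < z ≤ βY, and Fubini
exchanges the integral in z with the expectation. Integrability of `k` suffices; no sign is needed.
-/
lemma integral_one_sub_primitive {Ω : Type*} [MeasurableSpace Ω] {μ : Measure Ω}
    [IsProbabilityMeasure μ] {Y : Ω → ℝ} (hY : AEMeasurable Y μ) (hY0 : ∀ ω, 0 ≤ Y ω)
    {G k : ℝ → ℝ} (hk : IntegrableOn k (Ioi 0))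
    (hG : ∀ x, 0 ≤ x → G x = 1 - ∫ z in Ioc 0 x, k z) {β : ℝ} (hβ : 0 < β) :
    ∫ ω, G (β * Y ω) ∂μ = 1 - ∫ z in Ioi (0 : ℝ), k z * μ.real {ω | z / β ≤ Y ω} := by
  set f : Ω → ℝ → ℝ := fun ω z => indicator {p : Ω × ℝ | p.2 / β ≤ Y p.1} (fun p => k p.2) (ω, z)
    with hf
  have hset : NullMeasurableSet {p : Ω × ℝ | p.2 / β ≤ Y p.1}
      (μ.prod (volume.restrict (Ioi 0))) :=
    nullMeasurableSet_le (by fun_prop) (hY.comp_quasiMeasurePreserving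
      Measure.quasiMeasurePreserving_fst)
  have hfi : Integrable (Function.uncurry f) (μ.prod (volume.restrict (Ioi 0))) :=
    (Integrable.comp_snd (ν := volume.restrict (Ioi 0)) hk μ).indicator₀ hset
  have h1 : ∀ ω, G (β * Y ω) = 1 - ∫ z in Ioi (0 : ℝ), f ω z := by
    intro ω
    rw [hG _ (mul_nonneg hβ.le (hY0 ω)), ← Ioi_inter_Iic, inter_comm,
      ← Measure.restrict_restrict measurableSet_Iic, ← integral_indicator measurableSet_Iic]
    congr 1
    refine integral_congr_ae (ae_of_all _ fun z => ?_)
    simp only [hf, indicator, mem_Iic, mem_ofPred_eq, div_le_iff₀ hβ, mul_comm β]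
  have h2 : ∀ z, ∫ ω, f ω z ∂μ = k z * μ.real {ω | z / β ≤ Y ω} := by
    intro z
    have hm : NullMeasurableSet {ω | z / β ≤ Y ω} μ := nullMeasurableSet_le aemeasurable_const hY
    have e : (fun ω => f ω z) = indicator {ω | z / β ≤ Y ω} (fun _ => k z) := by
      ext ω
      simp [hf, indicator]
    rw [e, integral_indicator₀ hm, setIntegral_const, smul_eq_mul, mul_comm]
  simp_rw [h1]
  have h3 : Integrable (fun ω => ∫ z in Ioi (0 : ℝ), f ω z) μ := hfi.integral_prod_left
  rw [integral_sub (integrable_const _) h3, integral_integral_swap hfi]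
  simp_rw [h2]
  simp

/-- Tail probabilities z/β ≤ Υ are coverage probabilities at threshold z/β. The two terms are c = 1
and c = 2; for c = 1 the factor erfc 0 = 1 is omitted. -/
lemma IsDownlinkNetwork.asep_eq {Ω : Type*} [MeasurableSpace Ω] {μ : Measure Ω}
    [IsProbabilityMeasure μ] {lam P : ℝ} {X : ℕ → Ω → Plane} {h : ℕ → Ω → ℂ}
    (hnet : IsDownlinkNetwork μ lam X h) (hlam : 0 < lam) (hP : 0 < P) (w₁ w₂ : ℝ) {β₁ β₂ : ℝ}
    (hβ₁ : 0 < β₁) (hβ₂ : 0 < β₂) :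
    asep μ w₁ w₂ β₁ β₂ (sinr P 4 0 X h) =
      w₁ * (1 - 1 / √Real.pi * ∫ z in Ioi (0 : ℝ), Real.exp (-z) / √z *
        (1 / (1 + √(z / β₁) * Real.arctan √(z / β₁)))) +
      w₂ * (1 - 2 / √Real.pi * ∫ z in Ioi (0 : ℝ), Real.exp (-z) * erfc √z / √z *
        (1 / (1 + √(z / β₂) * Real.arctan √(z / β₂)))) := by
  have hm := hnet.aemeasurable_sinr hlam hP
  have h0 : ∀ ω, 0 ≤ sinr P 4 0 X h ω := sinr_nonneg hP
  have e1 := integral_one_sub_primitive hm h0 (integrableOn_exp_neg_div_sqrt.const_mul _)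
    (fun _ => erfc_sqrt_eq) hβ₁
  have e2 := integral_one_sub_primitive hm h0 (integrableOn_exp_neg_mul_erfc_div_sqrt.const_mul _)
    (G := fun x => erfc √x ^ 2) (fun _ => erfc_sqrt_sq_eq) hβ₂
  have r : ∀ β : ℝ, 0 < β → ∀ (c : ℝ) (k : ℝ → ℝ),
      ∫ z in Ioi (0 : ℝ), c * k z * μ.real {ω | z / β ≤ sinr P 4 0 X h ω} =
        c * ∫ z in Ioi (0 : ℝ), k z * (1 / (1 + √(z / β) * Real.arctan √(z / β))) := by
    intro β hβ c k
    rw [← integral_const_mul]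
    refine setIntegral_congr_fun measurableSet_Ioi fun z (hz : 0 < z) => ?_
    rw [hnet.measureReal_le_sinr hlam hP (by positivity), mul_assoc]
  rw [asep, e1, e2, r β₁ hβ₁ _ fun z => Real.exp (-z) / √z,
    r β₂ hβ₂ _ fun z => Real.exp (-z) * erfc √z / √z]

end Cellular

theorem mainTheorem6 {Ω : Type*} [MeasurableSpace Ω] (μ : Measure Ω) [IsProbabilityMeasure μ]
    (lam P : ℝ) (hlam : 0 < lam) (hP : 0 < P)
    (X : ℕ → Ω → Cellular.Plane) (h : ℕ → Ω → ℂ)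
    (hnet : Cellular.IsDownlinkNetwork μ lam X h) :
    -- the interference series converges almost surely
    (∀ᵐ ω ∂μ, Summable fun k : ℕ => Cellular.rxPower P 4 X h (k + 1) ω) ∧
    -- law of the service distance
    μ.map (Cellular.serviceDist X) = (volume.restrict (Ioi (0 : ℝ))).withDensity
      (fun r => ENNReal.ofReal (2 * Real.pi * lam * r * Real.exp (-(Real.pi * lam * r ^ 2)))) ∧
    -- the Laplace transform at `a r₀⁴ / P`, averaged over the service distance
    (∀ a : ℝ, 0 ≤ a →
      (∫ r in Ioi (0 : ℝ), 2 * Real.pi * lam * r * Real.exp (-(Real.pi * lam * r ^ 2)) *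
          Cellular.condLT μ P 4 X h (a * r ^ 4 / P) r) =
        (∫ r in Ioi (0 : ℝ), 2 * Real.pi * lam * r *
          Real.exp (-(Real.pi * lam * r ^ 2 * (√a * Real.arctan √a + 1)))) ∧
      (∫ r in Ioi (0 : ℝ), 2 * Real.pi * lam * r * Real.exp (-(Real.pi * lam * r ^ 2)) *
          Cellular.condLT μ P 4 X h (a * r ^ 4 / P) r) =
        1 / (1 + √a * Real.arctan √a) ∧
      (∫ ω, Real.exp (-(a * Cellular.serviceDist X ω ^ 4 / P *
          Cellular.interference P 4 X h ω)) ∂μ) =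
        1 / (1 + √a * Real.arctan √a)) ∧
    -- outage probability without noise
    (∀ T : ℝ, 0 ≤ T →
      Cellular.outage μ (Cellular.sinr P 4 0 X h) T = 1 - 1 / (1 + √T * Real.arctan √T)) ∧
    -- average symbol error probability without noise
    (∀ w₁ w₂ β₁ β₂ : ℝ, 0 < β₁ → 0 < β₂ →
      Cellular.asep μ w₁ w₂ β₁ β₂ (Cellular.sinr P 4 0 X h) =
        w₁ * (1 - 1 / √Real.pi * ∫ z in Ioi (0 : ℝ), Real.exp (-z) / √z *
          (1 / (1 + √(z / β₁) * Real.arctan √(z / β₁)))) +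
        w₂ * (1 - 2 / √Real.pi * ∫ z in Ioi (0 : ℝ), Real.exp (-z) * Cellular.erfc √z / √z *
          (1 / (1 + √(z / β₂) * Real.arctan √(z / β₂))))) := by
  refine ⟨hnet.ae_summable_rxPower hlam hP, hnet.ppp.map_serviceDist hlam hnet.ordered, fun a ha => ?_,
    fun T hT => hnet.outage_eq hlam hP hT,
    fun w₁ w₂ β₁ β₂ hβ₁ hβ₂ => hnet.asep_eq hlam hP w₁ w₂ hβ₁ hβ₂⟩
  have h1 := hnet.integral_exp_neg_interference hlam hP ha
  have h2 := (hnet.integral_condLT hlam hP ha).trans h1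
  have h3 := Cellular.integral_rayleigh_exponent hlam
    (mul_nonneg (Real.sqrt_nonneg a) (Real.arctan_nonneg.2 (Real.sqrt_nonneg a)))
  exact ⟨h2.trans h3.symm, h2, h1⟩
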